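/- **Setting.** Let $m\le n$ and let $\mathbb{R}^{m\times n}$ carry the trace inner product $\langle X,Y\rangle=\mathrm{tr}(X^{\mathbb T}Y)$ and its norm. Let $\Omega\subseteq\mathbb{R}^{m\times n}$ be closed and convex, $\nu>0$, and let $f:\mathbb{R}^{m\times n}\to\mathbb{R}$ be locally Lipschitz with $\widehat\partial f(X)=\partial f(X)$ for all $X\in\Omega$. Consider the rank regularized problem $$\min_{X\in\mathbb{R}^{m\times n}}\ \nu f(X)+\mathrm{rank}(X)+\delta_\Omega(X).$$ For a function $g$ on a Euclidean space $\mathbb{E}$ with values in $[-\infty,+\infty]$ and a point $z$ with $g(z)$ finite, the regular subdifferential is $$\widehat\partial g(z)=\Big\{v:\ \liminf_{y\to z,\,y\ne z}\frac{g(y)-g(z)-\langle v,y-z\rangle}{\|y-z\|}\ge 0\Big\},$$ and the limiting subdifferential $\partial g(z)$ is the set of all limits $v=\lim_k v^k$ with $v^k\in\widehat\partial g(y^k)$, $y^k\to z$, $g(y^k)\to g(z)$. For $S\subseteq\mathbb{E}$ and $z\in S$, the regular normal cone $\widehat{\mathcal N}_S(z)$ consists of the $v$ with $\limsup_{y\to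 z,\,y\in S\setminus\{z\}}\langle v,y-z\rangle/\|y-z\|\le0$, and the limiting normal cone $\mathcal N_S(z)$ is the set of all limits $v=\lim_k v^k$ with $v^k\in\widehat{\mathcal N}_S(y^k)$, $y^k\in S$, $y^k\to z$; for $z\notin S$ both cones are empty. The coderivative of a multifunction $\mathcal F$ at $(z,w)\in\mathrm{gph}\,\mathcal F$ is given by $u\in D^*\mathcal F(z|w)(v)\iff(u,-v)\in\mathcal N_{\mathrm{gph}\,\mathcal F}(z,w)$. Let $\sigma(X)\in\mathbb{R}^m$ be the vector of singular values of $X$ in nonincreasing order and $\|X\|_*=\sum_{i=1}^m\sigma_i(X)$ the nuclear norm. Let $\mathscr L$ be the family of proper lower semicontinuous convex functions $\phi:\mathbb{R}\to(-\infty,+\infty]$ with $[0,1]\subseteq\mathrm{int}(\mathrm{dom}\,\phi)$ and $\phi(1)=1$ that have a minimizer $t^*<1$ over $[0,1]$ with $\phi(t^*)=0$. Let $\mathscr L_1$ be the family of those $\phi\in\mathscr L$ that are differentiable at each point of $(0,1]$. For $\phi\in\mathscr L$ put $\widehat\phi(t)=\phi(|t|)$ for $t\in\mathbb{R}$ and $\widehat\Phi(x)=\sum_{i=1}^m\widehat\phi(x_i)$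 for $x\in\mathbb{R}^m$. A matrix $\overline X\in\mathbb{R}^{m\times n}$ is *R-stationary* if $$0\in\nu\,\partial f(\overline X)+\partial\,\mathrm{rank}(\overline X)+\mathcal N_\Omega(\overline X).$$ It is *M-stationary associated to* $\phi\in\mathscr L$ if there exist $\overline W\in\partial\|\cdot\|_*(\overline X)$ and $\Delta W\in\partial(\widehat\Phi\circ\sigma)(\overline W)$ such that $$0\in\nu\,\partial f(\overline X)+\mathcal N_\Omega(\overline X)+D^*\partial\|\cdot\|_*(\overline X|\overline W)(\Delta W).$$ **Theorem.** Let $\overline X\in\mathbb{R}^{m\times n}$. If $\overline X$ is M-stationary associated to some $\phi\in\mathscr L_1$, then $\overline X$ is R-stationary. Conversely, if $\overline X$ is R-stationary, then it is M-stationary associated to every $\phi\in\mathscr L$ with $0\in\partial\widehat\phi(0)$. -/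

import Mathlib

open Filter Topology
open scoped Pointwise

/-! ### The Euclidean space of real matrices with the trace inner product -/

attribute [local instance] Matrix.frobeniusNormedAddCommGroup Matrix.frobeniusNormedSpace

/-- The trace inner product `⟨X, Y⟩ = tr (Xᵀ Y)`, whose norm is the Frobenius norm. -/
noncomputable instance matrixTraceInner (m n : ℕ) :
    InnerProductSpace ℝ (Matrix (Fin m) (Fin n) ℝ) where
  inner X Y := (X.transpose * Y).trace
  norm_sq_eq_re_inner X := by
    have h : 0 ≤ ∑ i, ∑ j, ‖X i j‖ ^ (2 : ℝ) :=
      Finset.sum_nonneg fun i _ => Finset.sum_nonneg fun j _ => by positivity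
    rw [Matrix.frobenius_norm_def, ← Real.sqrt_eq_rpow, Real.sq_sqrt h, Finset.sum_comm]
    simp [Matrix.trace, Matrix.mul_apply, sq]
  conj_inner_symm X Y := by
    rw [← Matrix.trace_transpose (X.transpose * Y)]
    simp
  add_left X Y Z := by
    simp [Matrix.add_mul]
  smul_left X Y r := by
    simp

namespace RankReg

/-! ### Normal cones, subdifferentials and coderivatives -/

section Variational

variable {E : Type*} [NormedAddCommGroup E] [InnerProductSpace ℝ E]
variable {G : Type*} [NormedAddCommGroup G] [InnerProductSpace ℝ G]

/-- The regular normal cone to `S` at `z`: those `v` such that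
`limsup ⟪v, y - z⟫ / ‖y - z‖ ≤ 0` as `y → z` within `S`; it is empty when `z ∉ S`. -/
def regNormalCone (S : Set E) (z : E) : Set E :=
  {v | z ∈ S ∧ ∀ ε : ℝ, 0 < ε → ∀ᶠ y in 𝓝[S] z, inner ℝ v (y - z) ≤ ε * ‖y - z‖}

/-- The limiting normal cone to `S` at `z`: limits of regular normals at points of `S`
converging to `z`; it is empty when `z ∉ S`. -/
def limNormalCone (S : Set E) (z : E) : Set E :=
  {v | z ∈ S ∧ ∃ (y : ℕ → E) (w : ℕ → E),
    (∀ k, y k ∈ S) ∧ Tendsto y atTop (𝓝 z) ∧ Tendsto w atTop (𝓝 v) ∧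
      ∀ k, w k ∈ regNormalCone S (y k)}

/-- The regular subdifferential of `g` at a point `z` where `g z` is finite: those `v` such that
`liminf (g y - g z - ⟪v, y - z⟫) / ‖y - z‖ ≥ 0` as `y → z`, `y ≠ z`,
that is, `g y ≥ g z + ⟪v, y - z⟫ - o(‖y - z‖)`. It is empty when `g z` is not finite. -/
def regSubdiff (g : E → EReal) (z : E) : Set E :=
  {v | g z ≠ ⊤ ∧ g z ≠ ⊥ ∧ ∀ ε : ℝ, 0 < ε → ∀ᶠ y in 𝓝 z,
    g z + ((inner ℝ v (y - z) - ε * ‖y - z‖ : ℝ) : EReal) ≤ g y}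

/-- The limiting subdifferential of `g` at a point `z` where `g z` is finite: limits of regular
subgradients at points `y k → z` with `g (y k) → g z`. -/
def limSubdiff (g : E → EReal) (z : E) : Set E :=
  {v | g z ≠ ⊤ ∧ g z ≠ ⊥ ∧ ∃ (y : ℕ → E) (w : ℕ → E),
    Tendsto y atTop (𝓝 z) ∧ Tendsto (fun k => g (y k)) atTop (𝓝 (g z)) ∧
      Tendsto w atTop (𝓝 v) ∧ ∀ k, w k ∈ regSubdiff g (y k)}

/-- The graph of a multifunction, in the product with inner product
`⟪(a, b), (c, d)⟫ = ⟪a, c⟫ + ⟪b, d⟫`. -/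
def graph (F : E → Set G) : Set (WithLp 2 (E × G)) :=
  {p | p.snd ∈ F p.fst}

/-- The coderivative `D*F(z|w)`: `u ∈ D*F(z|w)(v)` iff `(u, -v)` is a limiting normal
to the graph of `F` at `(z, w)`. -/
def coderivative (F : E → Set G) (z : E) (w : G) (v : G) : Set E :=
  {u | WithLp.toLp 2 (u, -v) ∈ limNormalCone (graph F) (WithLp.toLp 2 (z, w))}

end Variational

/-! ### The family of functions `φ` -/

/-- The family `𝓛`: proper lower semicontinuous convex functions `φ : ℝ → (-∞, +∞]` with
`[0, 1] ⊆ int (dom φ)`, `φ 1 = 1`, and a minimizer `t < 1` of `φ` over `[0, 1]`, `φ t = 0`. -/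
structure IsClassL (φ : ℝ → EReal) : Prop where
  ne_bot : ∀ t, φ t ≠ ⊥
  ne_top : ∃ t, φ t ≠ ⊤
  lsc : LowerSemicontinuous φ
  convex : Convex ℝ {p : ℝ × ℝ | φ p.1 ≤ (p.2 : EReal)}
  dom : Set.Icc (0 : ℝ) 1 ⊆ interior {t | φ t < ⊤}
  map_one : φ 1 = 1
  argmin : ∃ t : ℝ, 0 ≤ t ∧ t < 1 ∧ IsMinOn φ (Set.Icc 0 1) t ∧ φ t = 0

/-- The family `𝓛₁`: those `φ ∈ 𝓛` that are differentiable at each point of `(0, 1]`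
(near such a point `φ` is finite, so `toReal` does not alter it). -/
def IsClassL1 (φ : ℝ → EReal) : Prop :=
  IsClassL φ ∧ ∀ t ∈ Set.Ioc (0 : ℝ) 1, DifferentiableAt ℝ (fun s => (φ s).toReal) t

/-- `φ̂ t = φ |t|`. -/
def hat (φ : ℝ → EReal) (t : ℝ) : EReal := φ |t|

/-! ### Singular values, nuclear norm and rank -/

section Matrices

variable {m n : ℕ}

/-- The singular value `σ_{i+1}(X)` in nonincreasing order (`i` counts from `0`). -/
noncomputable def sigma (X : Matrix (Fin m) (Fin n) ℝ) (i : Fin m) : ℝ :=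
  (Matrix.toEuclideanLin X).singularValues i

/-- The nuclear norm, the sum of the singular values, as an extended real valued function. -/
noncomputable def nuclearNorm (X : Matrix (Fin m) (Fin n) ℝ) : EReal :=
  ((∑ i, sigma X i : ℝ) : EReal)

/-- The subdifferential mapping `∂‖·‖_*` of the nuclear norm. -/
def subdiffNuclear (X : Matrix (Fin m) (Fin n) ℝ) : Set (Matrix (Fin m) (Fin n) ℝ) :=
  limSubdiff nuclearNorm X

/-- The rank as an extended real valued function. -/
noncomputable def rankFun (X : Matrix (Fin m) (Fin n) ℝ) : EReal :=
  ((X.rank : ℝ) : EReal)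

/-- `Φ̂ x = ∑ i, φ̂ (x i)`. -/
noncomputable def PhiHat (φ : ℝ → EReal) (x : Fin m → ℝ) : EReal :=
  ∑ i, hat φ (x i)

/-! ### Stationary points of `min ν f(X) + rank(X) + δ_Ω(X)` -/

/-- `X` is R-stationary: `0 ∈ ν ∂f(X) + ∂rank(X) + N_Ω(X)`. -/
def IsRStationary (ν : ℝ) (f : Matrix (Fin m) (Fin n) ℝ → ℝ)
    (Ω : Set (Matrix (Fin m) (Fin n) ℝ)) (X : Matrix (Fin m) (Fin n) ℝ) : Prop :=
  (0 : Matrix (Fin m) (Fin n) ℝ) ∈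
    ν • limSubdiff (fun Y => (f Y : EReal)) X + limSubdiff rankFun X + limNormalCone Ω X

/-- `X` is M-stationary associated to `φ`: there are `W ∈ ∂‖·‖_*(X)` and `ΔW ∈ ∂(Φ̂ ∘ σ)(W)` with
`0 ∈ ν ∂f(X) + N_Ω(X) + D*∂‖·‖_*(X|W)(ΔW)`. -/
def IsMStationary (ν : ℝ) (f : Matrix (Fin m) (Fin n) ℝ → ℝ)
    (Ω : Set (Matrix (Fin m) (Fin n) ℝ)) (φ : ℝ → EReal)
    (X : Matrix (Fin m) (Fin n) ℝ) : Prop :=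
  ∃ W ∈ subdiffNuclear X, ∃ ΔW ∈ limSubdiff (fun Y => PhiHat φ (sigma Y)) W,
    (0 : Matrix (Fin m) (Fin n) ℝ) ∈
      ν • limSubdiff (fun Y => (f Y : EReal)) X + limNormalCone Ω X
        + coderivative subdiffNuclear X W ΔW

end Matrices

end RankReg

/-! Both stationarity conditions share the terms `ν ∂f(X)` and `N_Ω(X)`, so it suffices to compare
`∂rank(X)` with the coderivative of `∂‖·‖_*`. Here `∂rank(X)` is the space of all `H` with `H Xᵀ =
0` and `Xᵀ H = 0`, and the graph of `∂‖·‖_*` is the set of polar pairs (`mem_subdiffNuclear_iff`).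

M to R (`coderivative_subset_limSubdiff_rankFun`): the graph is invariant under simultaneous
rotations of `X` and `W`, and for fixed `W` it contains a curve moving the factor `P = WᵀX`. Regular
normals annihilate these tangents, and the resulting identities survive limits. Rotation invariance
of `Φ̂ ∘ σ` makes `W ΔWᵀ` and `ΔWᵀ W` symmetric, which leaves `X Hᵀ` and `Hᵀ X` symmetric; the curve
in `P` then forces `Xᵀ H = 0` and `H Xᵀ = 0`.

R to M: take for `W` the partial isometry of the polar decomposition and `ΔW = c W`, with `c ≥ 1` a
slope supporting `φ` at `1` over `[0, ∞)`. Ky Fan type weights show that `c W` is a subgradient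
(`smul_mem_limSubdiff_PhiHat`). Every `H` in `∂rank(X)` lies in the coderivative at `c W`, because
nearby polar pairs have `X'` of the same rank and `‖W'‖ ≥ ‖W‖`
(`mem_coderivative_of_mul_transpose_eq_zero`). -/

namespace RankReg

/-! ### Regular normals tested along differentiable curves. -/

section Curves

variable {E : Type*} [NormedAddCommGroup E] [InnerProductSpace ℝ E]

theorem inner_nonpos_of_mem_regNormalCone {S : Set E} {z v d : E} {γ : ℝ → E}
    (hv : v ∈ regNormalCone S z) (hγ : HasDerivAt γ d 0) (h0 : γ 0 = z)
    (hS : ∀ t, γ t ∈ S) : inner ℝ v d ≤ 0 := by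
  have hslope : Tendsto (fun t : ℝ => t⁻¹ • (γ t - z)) (𝓝[>] 0) (𝓝 d) := by
    have h := hγ.tendsto_slope_zero_right
    simpa [h0] using h
  have hmem : Tendsto γ (𝓝[>] 0) (𝓝[S] z) := by
    refine tendsto_nhdsWithin_iff.2 ⟨?_, Eventually.of_forall hS⟩
    have h := hγ.continuousAt.tendsto
    rw [h0] at h
    exact h.mono_left nhdsWithin_le_nhds
  have key : ∀ ε : ℝ, 0 < ε → inner ℝ v d ≤ ε * ‖d‖ := by
    intro ε hε
    have h1 : Tendsto (fun t : ℝ => inner ℝ v (t⁻¹ • (γ t - z))) (𝓝[>] 0) (𝓝 (inner ℝ v d)) :=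
      tendsto_const_nhds.inner hslope
    have h2 : Tendsto (fun t : ℝ => ε * ‖t⁻¹ • (γ t - z)‖) (𝓝[>] 0) (𝓝 (ε * ‖d‖)) :=
      hslope.norm.const_mul ε
    refine le_of_tendsto_of_tendsto h1 h2 ?_
    filter_upwards [hmem.eventually (hv.2 ε hε), self_mem_nhdsWithin] with t ht htpos
    have htpos' : 0 < t⁻¹ := inv_pos.2 htpos
    rw [inner_smul_right, norm_smul, Real.norm_of_nonneg htpos'.le]
    nlinarith [mul_le_mul_of_nonneg_left ht htpos'.le]
  refine le_of_forall_pos_le_add fun δ hδ => ?_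
  have h := key (δ / (‖d‖ + 1)) (by positivity)
  have h3 : δ / (‖d‖ + 1) * ‖d‖ ≤ δ := by
    rw [div_mul_eq_mul_div, div_le_iff₀ (by positivity)]
    nlinarith [norm_nonneg d]
  linarith

theorem inner_eq_zero_of_mem_regNormalCone {S : Set E} {z v d : E} {γ : ℝ → E}
    (hv : v ∈ regNormalCone S z) (hγ : HasDerivAt γ d 0) (h0 : γ 0 = z)
    (hS : ∀ t, γ t ∈ S) : inner ℝ v d = 0 := by
  refine le_antisymm (inner_nonpos_of_mem_regNormalCone hv hγ h0 hS) ?_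
  have h1 : HasDerivAt (fun t : ℝ => γ (-t)) (-d) 0 := by
    have := HasDerivAt.scomp (h := fun t : ℝ => -t) (h' := -1) (g₁ := γ) (g₁' := d) (0 : ℝ)
      (by simpa using hγ) (hasDerivAt_neg 0)
    simpa [Function.comp_def] using this
  have := inner_nonpos_of_mem_regNormalCone hv h1 (by simpa using h0) (fun t => hS (-t))
  rw [inner_neg_right] at this
  linarith

/-- On the sublevel set `g y - g z ≤ 0`, so the subgradient inequality leaves only the inner product
term. This lets the curve arguments serve the rank and `Φ̂ ∘ σ` too. -/
theorem mem_regNormalCone_sublevel {g : E → EReal} {z v : E} (hv : v ∈ regSubdiff g z) :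
    v ∈ regNormalCone {y | g y ≤ g z} z := by
  refine ⟨le_refl (g z), fun ε hε => ?_⟩
  filter_upwards [mem_nhdsWithin_of_mem_nhds (hv.2.2 ε hε), self_mem_nhdsWithin] with y hy hyS
  have h := le_trans hy hyS
  lift g z to ℝ using ⟨hv.1, hv.2.1⟩ with r
  rw [← EReal.coe_add, EReal.coe_le_coe_iff] at h
  linarith

theorem hasDerivAt_rotation_curve (x a b : E) :
    HasDerivAt (fun t : ℝ => x + Real.sin t • a + (1 - Real.cos t) • b) a 0 := by
  have h1 := (Real.hasDerivAt_sin 0).smul_const a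
  have h2 := ((hasDerivAt_const (0 : ℝ) (1 : ℝ)).sub (Real.hasDerivAt_cos 0)).smul_const b
  have h := ((hasDerivAt_const (0 : ℝ) x).add h1).add h2
  convert! h using 1
  simp

end Curves

/-! ### Plane rotations and their generators. -/

section Rotations

open Matrix

variable {k : ℕ}

/-- The generator of the rotations of the plane spanned by the `i`-th and `j`-th axes. -/
def rotGen (i j : Fin k) : Matrix (Fin k) (Fin k) ℝ := Matrix.single i j 1 - Matrix.single j i 1

/-- The rotation by the angle `t` of the plane spanned by the `i`-th and `j`-th axes. -/
noncomputable def rot (i j : Fin k) (t : ℝ) : Matrix (Fin k) (Fin k) ℝ :=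
  1 + Real.sin t • rotGen i j + (1 - Real.cos t) • (rotGen i j * rotGen i j)

theorem rotGen_transpose (i j : Fin k) : (rotGen i j)ᵀ = -rotGen i j := by
  simp [rotGen]

/-- With `J³ = -J` the exponential of `tJ` collapses to `1 + sin t J + (1 - cos t) J²`, the formula
defining `rot`. -/
theorem rotGen_cube {i j : Fin k} (hij : i ≠ j) :
    rotGen i j * rotGen i j * rotGen i j = -rotGen i j := by
  simp [rotGen, sub_mul, mul_sub, hij, hij.symm]
  abel

@[simp]
theorem rot_zero (i j : Fin k) : rot i j 0 = 1 := by simp [rot]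

theorem rot_transpose_mul_self {i j : Fin k} (hij : i ≠ j) (t : ℝ) :
    (rot i j t)ᵀ * rot i j t = 1 := by
  have h3 := rotGen_cube hij
  have h4 : rotGen i j * rotGen i j * (rotGen i j * rotGen i j)
      = -(rotGen i j * rotGen i j) := by rw [← mul_assoc, h3, neg_mul]
  have h3' : rotGen i j * (rotGen i j * rotGen i j) = -rotGen i j := by rw [← mul_assoc, h3]
  have hs : Real.sin t * Real.sin t = 1 - Real.cos t * Real.cos t := by
    nlinarith [Real.sin_sq_add_cos_sq t]
  simp only [rot, transpose_add, transpose_one, transpose_smul, transpose_mul, rotGen_transpose,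
    add_mul, mul_add, one_mul, mul_one, smul_mul_assoc, mul_smul_comm, h4, h3, h3',
    smul_neg, neg_mul, mul_neg]
  match_scalars <;> linarith

theorem rot_mul_transpose_self {i j : Fin k} (hij : i ≠ j) (t : ℝ) :
    rot i j t * (rot i j t)ᵀ = 1 :=
  mul_eq_one_comm.1 (rot_transpose_mul_self hij t)

/-- The generators span the skew matrices, so `B` is orthogonal to all of them only if its skew part
vanishes. -/
theorem transpose_eq_of_trace_rotGen_mul {B : Matrix (Fin k) (Fin k) ℝ}
    (h : ∀ i j, i ≠ j → (rotGen i j * B).trace = 0) : Bᵀ = B := by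
  ext i j
  rcases eq_or_ne i j with rfl | hij
  · rfl
  have := h i j hij
  simp only [rotGen, sub_mul, trace_sub, trace_single_mul] at this
  simp only [transpose_apply]
  simpa [sub_eq_zero] using this

variable {m n : ℕ}

theorem inner_eq_trace (X Y : Matrix (Fin m) (Fin n) ℝ) : inner ℝ X Y = (Xᵀ * Y).trace := rfl

theorem hasDerivAt_rot_mul (i j : Fin m) (X : Matrix (Fin m) (Fin n) ℝ) :
    HasDerivAt (fun t => rot i j t * X) (rotGen i j * X) 0 := by
  convert! hasDerivAt_rotation_curve X (rotGen i j * X) (rotGen i j * rotGen i j * X) using 1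
  ext1 t
  simp only [rot, Matrix.add_mul, Matrix.smul_mul, Matrix.one_mul]

theorem hasDerivAt_mul_rot (i j : Fin n) (X : Matrix (Fin m) (Fin n) ℝ) :
    HasDerivAt (fun t => X * rot i j t) (X * rotGen i j) 0 := by
  convert! hasDerivAt_rotation_curve X (X * rotGen i j) (X * (rotGen i j * rotGen i j)) using 1
  ext1 t
  simp only [rot, Matrix.mul_add, Matrix.mul_smul, Matrix.mul_one]

end Rotations

/-! ### Orthogonal invariance of singular values and the thin singular value decomposition. -/

section SVD

open Matrix

variable {m n : ℕ}

theorem adjoint_comp_toEuclideanLin (X : Matrix (Fin m) (Fin n) ℝ) :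
    (toEuclideanLin X).adjoint ∘ₗ toEuclideanLin X = toEuclideanLin (Xᵀ * X) := by
  rw [← toEuclideanLin_conjTranspose_eq_adjoint, conjTranspose_eq_transpose_of_trivial]
  ext v i
  simp [toEuclideanLin]

theorem charpoly_toEuclideanLin {k : ℕ} (A : Matrix (Fin k) (Fin k) ℝ) :
    (toEuclideanLin A).charpoly = A.charpoly := by
  rw [toEuclideanLin, toLpLin_eq_toLin]
  exact charpoly_toLin A _

theorem sigma_eq_of_charpoly_eq {X Y : Matrix (Fin m) (Fin n) ℝ}
    (h : (Xᵀ * X).charpoly = (Yᵀ * Y).charpoly) : sigma X = sigma Y := by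
  have key : (toEuclideanLin X).isSymmetric_adjoint_comp_self.eigenvalues (n := n) (by simp)
      = (toEuclideanLin Y).isSymmetric_adjoint_comp_self.eigenvalues (n := n) (by simp) := by
    rw [LinearMap.IsSymmetric.eigenvalues_eq_eigenvalues_iff, adjoint_comp_toEuclideanLin,
      adjoint_comp_toEuclideanLin, charpoly_toEuclideanLin, charpoly_toEuclideanLin, h]
  ext i
  simp only [sigma]
  -- Without `m ≤ n` an index may exceed the number of eigenvalues of `XᵀX`; both singular values
  -- are then `0` by convention.
  rcases lt_or_ge (i : ℕ) n with hi | hi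
  · rw [LinearMap.singularValues_of_lt _ (n := n) (by simp) hi,
      LinearMap.singularValues_of_lt _ (n := n) (by simp) hi, key]
  · rw [LinearMap.singularValues_of_finrank_le, LinearMap.singularValues_of_finrank_le] <;>
    simpa using hi

theorem sigma_mul_left {P : Matrix (Fin m) (Fin m) ℝ} (hP : Pᵀ * P = 1)
    (X : Matrix (Fin m) (Fin n) ℝ) : sigma (P * X) = sigma X := by
  apply sigma_eq_of_charpoly_eq
  rw [transpose_mul, Matrix.mul_assoc, ← Matrix.mul_assoc Pᵀ, hP, Matrix.one_mul]

theorem sigma_mul_right {Q : Matrix (Fin n) (Fin n) ℝ} (hQ : Q * Qᵀ = 1)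
    (X : Matrix (Fin m) (Fin n) ℝ) : sigma (X * Q) = sigma X := by
  apply sigma_eq_of_charpoly_eq
  rw [transpose_mul, Matrix.mul_assoc, charpoly_mul_comm, Matrix.mul_assoc, Matrix.mul_assoc, hQ,
    Matrix.mul_one]

theorem sigma_nonneg (X : Matrix (Fin m) (Fin n) ℝ) (i : Fin m) : 0 ≤ sigma X i :=
  LinearMap.singularValues_nonneg _ _

/-- An orthonormal eigenbasis of `XᵀX` is mapped by `X` to orthogonal vectors of lengths `σ_i`. The
nonzero images, normalized, extend to an orthonormal basis of the target; only the first `m`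
eigenvectors matter since the rank is at most `m`. -/
theorem exists_svd (hmn : m ≤ n) (X : Matrix (Fin m) (Fin n) ℝ) :
    ∃ (U : Matrix (Fin m) (Fin m) ℝ) (V : Matrix (Fin n) (Fin m) ℝ),
      Uᵀ * U = 1 ∧ Vᵀ * V = 1 ∧ X = U * diagonal (sigma X) * Vᵀ := by
  set T := toEuclideanLin X with hT
  have hn : Module.finrank ℝ (EuclideanSpace ℝ (Fin n)) = n := by simp
  set hs := T.isSymmetric_adjoint_comp_self
  set v := hs.eigenvectorBasis hn with hv
  have hTT : ∀ j k, inner ℝ (T (v j)) (T (v k))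
      = if j = k then (T.singularValues k) ^ 2 else 0 := by
    intro j k
    have h1 := hs.apply_eigenvectorBasis hn k
    rw [← LinearMap.adjoint_inner_right, ← LinearMap.comp_apply, h1, inner_smul_right,
      orthonormal_iff_ite.1 v.orthonormal, ← T.sq_singularValues_fin hn]
    simp
  have hzero : ∀ k : Fin n, T.singularValues k = 0 → T (v k) = 0 := by
    intro k hk
    have := hTT k k
    rwa [if_pos rfl, hk, zero_pow two_ne_zero, inner_self_eq_zero] at this
  let s : Set (Fin m) := {i | sigma X i ≠ 0}
  let w : Fin m → EuclideanSpace ℝ (Fin m) :=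
    fun i => (sigma X i)⁻¹ • T (v (Fin.castLE hmn i))
  have hw : Orthonormal ℝ (s.domRestrict w) := by
    rw [orthonormal_iff_ite]
    rintro ⟨i, hi⟩ ⟨j, hj⟩
    have hi' : sigma X i ≠ 0 := hi
    simp only [Set.domRestrict_apply, w, inner_smul_left, inner_smul_right, hTT, Subtype.mk.injEq,
      (Fin.castLE_injective hmn).eq_iff]
    split_ifs with h
    · subst h
      simp only [sigma, Fin.val_castLE] at hi' ⊢
      rw [hT]
      simp
      field_simp
    · simp
  obtain ⟨b, hb⟩ := hw.exists_orthonormalBasis_extension_of_card_eq (by simp)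
  have hTv : ∀ i : Fin m, T (v (Fin.castLE hmn i)) = sigma X i • b i := by
    intro i
    by_cases hi : sigma X i = 0
    · rw [hi, zero_smul]
      exact hzero _ hi
    · rw [hb i hi, smul_smul, mul_inv_cancel₀ hi, one_smul]
  have hTv0 : ∀ k : Fin n, m ≤ k → T (v k) = 0 := by
    intro k hk
    apply hzero
    rw [LinearMap.singularValues_eq_zero_iff_le_finrank_range]
    refine le_trans (Submodule.finrank_le _) ?_
    simpa using hk
  refine ⟨of fun i k => b k i, of fun j k => v (Fin.castLE hmn k) j, ?_, ?_, ?_⟩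
  · ext i j
    rw [one_apply, ← orthonormal_iff_ite.1 b.orthonormal i j, PiLp.inner_apply, mul_apply]
    exact Finset.sum_congr rfl fun k _ => mul_comm _ _
  · ext i j
    have h := orthonormal_iff_ite.1 v.orthonormal (Fin.castLE hmn i) (Fin.castLE hmn j)
    simp only [(Fin.castLE_injective hmn).eq_iff] at h
    rw [one_apply, ← h, PiLp.inner_apply, mul_apply]
    exact Finset.sum_congr rfl fun k _ => mul_comm _ _
  · ext i j
    have h1 : T (EuclideanSpace.single j 1)
        = ∑ k : Fin n, (v k j) • T (v k) := by
      conv_lhs => rw [← v.sum_repr (EuclideanSpace.single j 1)]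
      simp only [map_sum, map_smul, OrthonormalBasis.repr_apply_apply,
        EuclideanSpace.inner_single_right, one_mul, conj_trivial]
    have h2 : ∑ k : Fin n, (v k j) • T (v k)
        = ∑ k : Fin m, (v (Fin.castLE hmn k) j) • T (v (Fin.castLE hmn k)) := by
      symm
      refine Finset.sum_of_injOn (Fin.castLE hmn) (Fin.castLE_injective hmn).injOn (by simp) ?_
        (by simp)
      intro k _ hk
      rw [hTv0 k, smul_zero]
      by_contra hlt
      exact hk ⟨⟨k, by omega⟩, by simp⟩
    have h3 : T (EuclideanSpace.single j 1) i = X i j := by simp [hT, toEuclideanLin]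
    rw [← h3, h1, h2, mul_apply]
    simp only [hTv, WithLp.ofLp_sum, WithLp.ofLp_smul, Finset.sum_apply, Pi.smul_apply,
      smul_eq_mul]
    refine Finset.sum_congr rfl fun k _ => ?_
    rw [mul_diagonal, of_apply, transpose_apply, of_apply]
    ring

end SVD

/-! ### Contractions, nuclear norm duality and the graph of `∂‖·‖_*`. -/

section Polar

open Matrix

variable {m n k : ℕ}

/-- `W` has operator norm at most one. -/
def IsContr (W : Matrix (Fin m) (Fin n) ℝ) : Prop := (1 - Wᵀ * W).PosSemidef

theorem posSemidef_transpose_mul_self (C : Matrix (Fin k) (Fin n) ℝ) : (Cᵀ * C).PosSemidef := by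
  simpa using posSemidef_conjTranspose_mul_self C

theorem PosSemidef.transpose_mul_mul_same' {P : Matrix (Fin n) (Fin n) ℝ} (hP : P.PosSemidef)
    (C : Matrix (Fin n) (Fin k) ℝ) : (Cᵀ * P * C).PosSemidef := by
  simpa using hP.conjTranspose_mul_mul_same C

open MatrixOrder in
theorem exists_eq_transpose_mul_self {P : Matrix (Fin n) (Fin n) ℝ} (hP : P.PosSemidef) :
    ∃ C : Matrix (Fin n) (Fin n) ℝ, P = Cᵀ * C := by
  obtain ⟨C, hC⟩ := CStarAlgebra.nonneg_iff_eq_star_mul_self.1 hP.nonneg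
  exact ⟨C, by simpa [star_eq_conjTranspose] using hC⟩

theorem transpose_eq_of_posSemidef {P : Matrix (Fin n) (Fin n) ℝ} (hP : P.PosSemidef) :
    Pᵀ = P := by
  simpa using hP.isHermitian.eq

theorem eq_zero_of_trace_transpose_mul_self {A : Matrix (Fin m) (Fin n) ℝ}
    (h : (Aᵀ * A).trace = 0) : A = 0 := by
  rwa [← inner_eq_trace, inner_self_eq_zero] at h

theorem trace_transpose_mul_self_nonneg (A : Matrix (Fin m) (Fin n) ℝ) : 0 ≤ (Aᵀ * A).trace := by
  rw [← inner_eq_trace]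
  exact real_inner_self_nonneg

theorem mul_eq_zero_of_trace_nonpos {P : Matrix (Fin n) (Fin n) ℝ} (hP : P.PosSemidef)
    {M : Matrix (Fin n) (Fin k) ℝ} (h : (Mᵀ * P * M).trace ≤ 0) : P * M = 0 := by
  obtain ⟨C, rfl⟩ := exists_eq_transpose_mul_self hP
  have h1 : Mᵀ * (Cᵀ * C) * M = (C * M)ᵀ * (C * M) := by
    simp only [transpose_mul, Matrix.mul_assoc]
  rw [h1] at h
  have := eq_zero_of_trace_transpose_mul_self
    (le_antisymm h (trace_transpose_mul_self_nonneg _))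
  rw [Matrix.mul_assoc, this, Matrix.mul_zero]

/-- The defect in the trace inequality for two contractions and a positive semidefinite matrix
`CᵀC`. -/
theorem trace_sub_inner_contr (A W : Matrix (Fin m) (Fin n) ℝ) (C : Matrix (Fin n) (Fin n) ℝ) :
    2 * ((Cᵀ * C).trace - inner ℝ A (W * (Cᵀ * C)))
      = (((W - A) * Cᵀ)ᵀ * ((W - A) * Cᵀ)).trace + (C * (1 - Wᵀ * W) * Cᵀ).trace
        + (C * (1 - Aᵀ * A) * Cᵀ).trace := by
  have h1 : (C * Cᵀ).trace = (Cᵀ * C).trace := trace_mul_comm _ _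
  have h2 : (C * (Aᵀ * (W * Cᵀ))).trace = (Aᵀ * (W * (Cᵀ * C))).trace := by
    rw [trace_mul_comm]
    simp only [Matrix.mul_assoc]
  have h3 : (C * (Wᵀ * (A * Cᵀ))).trace = (Aᵀ * (W * (Cᵀ * C))).trace := by
    rw [← h2, ← trace_transpose]
    simp only [transpose_mul, transpose_transpose, Matrix.mul_assoc]
  rw [inner_eq_trace]
  simp only [transpose_mul, transpose_sub, transpose_transpose, Matrix.mul_sub, Matrix.sub_mul,
    Matrix.mul_one, Matrix.mul_assoc, trace_sub, h1, h2, h3]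
  ring

theorem IsContr.trace_nonneg {W : Matrix (Fin m) (Fin n) ℝ} (hW : IsContr W)
    (C : Matrix (Fin k) (Fin n) ℝ) : 0 ≤ (C * (1 - Wᵀ * W) * Cᵀ).trace := by
  have := (PosSemidef.transpose_mul_mul_same' hW Cᵀ).trace_nonneg
  rwa [transpose_transpose] at this

theorem inner_mul_le_trace {A W : Matrix (Fin m) (Fin n) ℝ} (hA : IsContr A) (hW : IsContr W)
    {P : Matrix (Fin n) (Fin n) ℝ} (hP : P.PosSemidef) : inner ℝ A (W * P) ≤ P.trace := by
  obtain ⟨C, rfl⟩ := exists_eq_transpose_mul_self hP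
  have := trace_sub_inner_contr A W C
  linarith [trace_transpose_mul_self_nonneg ((W - A) * Cᵀ), hA.trace_nonneg C, hW.trace_nonneg C]

/-- Equality case: all three nonnegative terms of `trace_sub_inner_contr` must vanish. -/
theorem mul_eq_mul_of_trace_le_inner {A W : Matrix (Fin m) (Fin n) ℝ} (hA : IsContr A)
    (hW : IsContr W) {P : Matrix (Fin n) (Fin n) ℝ} (hP : P.PosSemidef)
    (h : P.trace ≤ inner ℝ A (W * P)) : W * P = A * P ∧ Aᵀ * A * P = P := by
  obtain ⟨C, rfl⟩ := exists_eq_transpose_mul_self hP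
  have key := trace_sub_inner_contr A W C
  have h1 := trace_transpose_mul_self_nonneg ((W - A) * Cᵀ)
  have h2 := hA.trace_nonneg C
  have h3 := hW.trace_nonneg C
  have h4 : (W - A) * Cᵀ = 0 := eq_zero_of_trace_transpose_mul_self (by linarith)
  have h5 : (1 - Aᵀ * A) * Cᵀ = 0 := by
    refine mul_eq_zero_of_trace_nonpos hA ?_
    rw [transpose_transpose]
    linarith
  constructor
  · rw [← sub_eq_zero, ← Matrix.sub_mul, ← Matrix.mul_assoc, h4, Matrix.zero_mul]
  · rw [← sub_eq_zero, ← neg_eq_zero, neg_sub]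
    calc Cᵀ * C - Aᵀ * A * (Cᵀ * C) = ((1 - Aᵀ * A) * Cᵀ) * C := by
          simp only [Matrix.sub_mul, Matrix.one_mul, Matrix.mul_assoc]
      _ = 0 := by rw [h5, Matrix.zero_mul]

/-- The sum of the singular values. -/
noncomputable def nuc (X : Matrix (Fin m) (Fin n) ℝ) : ℝ := ∑ i, sigma X i

theorem isContr_mul_transpose {U : Matrix (Fin m) (Fin m) ℝ} {V : Matrix (Fin n) (Fin m) ℝ}
    (hU : Uᵀ * U = 1) (hV : Vᵀ * V = 1) : IsContr (U * Vᵀ) := by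
  have h : 1 - (U * Vᵀ)ᵀ * (U * Vᵀ) = (1 - V * Vᵀ)ᵀ * (1 - V * Vᵀ) := by
    have h1 : V * Vᵀ * (V * Vᵀ) = V * Vᵀ := by
      rw [Matrix.mul_assoc, ← Matrix.mul_assoc Vᵀ, hV, Matrix.one_mul]
    have h2 : V * Uᵀ * (U * Vᵀ) = V * Vᵀ := by
      rw [Matrix.mul_assoc, ← Matrix.mul_assoc Uᵀ, hU, Matrix.one_mul]
    simp only [transpose_mul, transpose_sub, transpose_one, transpose_transpose, mul_sub, sub_mul,
      mul_one, one_mul, h1, h2]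
    abel
  unfold IsContr
  rw [h]
  exact posSemidef_transpose_mul_self _

theorem exists_polar (hmn : m ≤ n) (X : Matrix (Fin m) (Fin n) ℝ) :
    ∃ (A : Matrix (Fin m) (Fin n) ℝ) (P : Matrix (Fin n) (Fin n) ℝ),
      IsContr A ∧ P.PosSemidef ∧ X = A * P ∧ P.trace = nuc X ∧ inner ℝ A X = nuc X := by
  obtain ⟨U, V, hU, hV, hX⟩ := exists_svd hmn X
  have hP : (V * diagonal (sigma X) * Vᵀ).PosSemidef := by
    have : (diagonal (sigma X)).PosSemidef := PosSemidef.diagonal fun i => sigma_nonneg X i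
    simpa using PosSemidef.transpose_mul_mul_same' this Vᵀ
  refine ⟨U * Vᵀ, V * diagonal (sigma X) * Vᵀ, isContr_mul_transpose hU hV, hP, ?_, ?_, ?_⟩
  · conv_lhs => rw [hX]
    simp only [Matrix.mul_assoc]
    rw [← Matrix.mul_assoc Vᵀ V, hV, Matrix.one_mul]
  · rw [trace_mul_cycle, hV, Matrix.one_mul, trace_diagonal, nuc]
  · conv_lhs => rw [hX]
    rw [inner_eq_trace, transpose_mul, transpose_transpose, Matrix.mul_assoc, ← Matrix.mul_assoc Uᵀ,
      ← Matrix.mul_assoc Uᵀ, hU, Matrix.one_mul, ← Matrix.mul_assoc, trace_mul_cycle, hV,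
      Matrix.one_mul, trace_diagonal, nuc]

/-- Together with `exists_polar`, where the bound is attained, this exhibits the nuclear norm as the
support function of the contractions. -/
theorem IsContr.inner_le_nuc (hmn : m ≤ n) {W : Matrix (Fin m) (Fin n) ℝ} (hW : IsContr W)
    (X : Matrix (Fin m) (Fin n) ℝ) : inner ℝ W X ≤ nuc X := by
  obtain ⟨A, P, hA, hP, hX, htr, -⟩ := exists_polar hmn X
  rw [← htr, hX]
  exact inner_mul_le_trace hW hA hP

/-- The pairs `(X, W)` in the graph of the subdifferential of the nuclear norm: `W` is a
contraction and `WᵀX` is the positive semidefinite factor of the polar decomposition of `X`. -/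
def IsPolarPair (X W : Matrix (Fin m) (Fin n) ℝ) : Prop :=
  IsContr W ∧ (Wᵀ * X).PosSemidef ∧ W * Wᵀ * X = X

theorem isPolarPair_iff (hmn : m ≤ n) {X W : Matrix (Fin m) (Fin n) ℝ} :
    IsPolarPair X W ↔ IsContr W ∧ nuc X ≤ inner ℝ W X := by
  constructor
  · rintro ⟨hW, hP, hWX⟩
    refine ⟨hW, ?_⟩
    obtain ⟨A, P, hA, -, -, -, hAX⟩ := exists_polar hmn X
    have := inner_mul_le_trace hA hW hP
    rwa [← Matrix.mul_assoc, hWX, hAX] at this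
  · rintro ⟨hW, h⟩
    obtain ⟨A, P, hA, hP, hX, htr, -⟩ := exists_polar hmn X
    rw [← htr, hX] at h
    obtain ⟨h1, h2⟩ := mul_eq_mul_of_trace_le_inner hW hA hP h
    have h3 : Wᵀ * X = P := by rw [hX, h1, ← Matrix.mul_assoc, h2]
    refine ⟨hW, h3 ▸ hP, ?_⟩
    rw [Matrix.mul_assoc, h3, hX, h1]

/-- Test with the rank one matrix `Z = (Wx)xᵀ`, whose nuclear norm is attained at a contraction `A`.
Then `‖Wx‖² ≤ ⟨Wx, Ax⟩`, hence `‖Wx‖ ≤ ‖Ax‖ ≤ ‖x‖`. -/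
theorem isContr_of_inner_le_nuc (hmn : m ≤ n) {W : Matrix (Fin m) (Fin n) ℝ}
    (h : ∀ Z, inner ℝ W Z ≤ nuc Z) : IsContr W := by
  have hvec : ∀ (B : Matrix (Fin m) (Fin n) ℝ) (x : Fin n → ℝ) (y : Fin m → ℝ),
      inner ℝ B (vecMulVec y x) = y ⬝ᵥ (B *ᵥ x) := by
    intro B x y
    rw [inner_eq_trace, mul_vecMulVec, trace_vecMulVec, mulVec_transpose, dotProduct_mulVec]
  refine PosSemidef.of_dotProduct_mulVec_nonneg ?_ fun x => ?_
  · simp [IsHermitian, transpose_mul]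
  have hexp : ∀ B : Matrix (Fin m) (Fin n) ℝ,
      x ⬝ᵥ ((1 - Bᵀ * B) *ᵥ x) = x ⬝ᵥ x - (B *ᵥ x) ⬝ᵥ (B *ᵥ x) := by
    intro B
    rw [sub_mulVec, one_mulVec, dotProduct_sub, ← mulVec_mulVec, dotProduct_mulVec x Bᵀ,
      vecMul_transpose]
  obtain ⟨A, P, hA, -, -, -, hAX⟩ := exists_polar hmn (vecMulVec (W *ᵥ x) x)
  have h1 := h (vecMulVec (W *ᵥ x) x)
  rw [← hAX, hvec, hvec] at h1
  have h2 : 0 ≤ x ⬝ᵥ ((1 - Aᵀ * A) *ᵥ x) := by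
    simpa using hA.dotProduct_mulVec_nonneg x
  rw [star_trivial, hexp]
  rw [hexp] at h2
  have h3 : 0 ≤ (W *ᵥ x - A *ᵥ x) ⬝ᵥ (W *ᵥ x - A *ᵥ x) := by
    simpa using dotProduct_star_self_nonneg (W *ᵥ x - A *ᵥ x)
  rw [sub_dotProduct, dotProduct_sub, dotProduct_sub, dotProduct_comm (A *ᵥ x) (W *ᵥ x)] at h3
  linarith

theorem nuc_add_smul_le (hmn : m ≤ n) (X D : Matrix (Fin m) (Fin n) ℝ) {t : ℝ} (ht : 0 ≤ t) :
    nuc (X + t • D) ≤ nuc X + t * nuc D := by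
  obtain ⟨A, P, hA, -, -, -, h⟩ := exists_polar hmn (X + t • D)
  rw [← h, inner_add_right, inner_smul_right]
  have := hA.inner_le_nuc hmn X
  have := mul_le_mul_of_nonneg_left (hA.inner_le_nuc hmn D) ht
  linarith

theorem nuc_one_sub_smul_le (hmn : m ≤ n) (X : Matrix (Fin m) (Fin n) ℝ) {t : ℝ} (ht : t ≤ 1) :
    nuc ((1 - t) • X) ≤ (1 - t) * nuc X := by
  obtain ⟨A, P, hA, -, -, -, h⟩ := exists_polar hmn ((1 - t) • X)
  rw [← h, inner_smul_right]
  exact mul_le_mul_of_nonneg_left (hA.inner_le_nuc hmn X) (by linarith)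

theorem nuclearNorm_eq_coe_nuc (X : Matrix (Fin m) (Fin n) ℝ) : nuclearNorm X = (nuc X : EReal) :=
  rfl

/-- Directional form of the regular subgradient inequality. -/
theorem inner_le_of_mem_regSubdiff {E : Type*} [NormedAddCommGroup E] [InnerProductSpace ℝ E]
    {g : E → EReal} {z v d : E} {p a : ℝ} (hv : v ∈ regSubdiff g z) (hp : g z = p)
    (h : ∀ᶠ t : ℝ in 𝓝[>] 0, g (z + t • d) ≤ ((p + t * a : ℝ) : EReal)) : inner ℝ v d ≤ a := by
  refine le_of_forall_pos_le_add fun δ hδ => ?_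
  have hε : 0 < δ / (‖d‖ + 1) := by positivity
  have htend : Tendsto (fun t : ℝ => z + t • d) (𝓝[>] 0) (𝓝 z) := by
    have : Continuous fun t : ℝ => z + t • d := by fun_prop
    have h0 := this.tendsto 0
    simp only [zero_smul, add_zero] at h0
    exact h0.mono_left nhdsWithin_le_nhds
  obtain ⟨t, h1, h2, h3⟩ := ((htend.eventually (hv.2.2 _ hε)).and
    (h.and self_mem_nhdsWithin)).exists
  have ht : (0 : ℝ) < t := h3
  replace h1 := h1.trans h2
  rw [hp, ← EReal.coe_add, EReal.coe_le_coe_iff, add_sub_cancel_left, inner_smul_right, norm_smul,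
    Real.norm_of_nonneg ht.le] at h1
  have h4 : δ / (‖d‖ + 1) * ‖d‖ ≤ δ := by
    rw [div_mul_eq_mul_div, div_le_iff₀ (by positivity)]
    nlinarith [norm_nonneg d]
  have h5 : t * inner ℝ v d ≤ t * (a + δ) := by nlinarith
  exact le_of_mul_le_mul_left h5 ht

/-- Sublinearity in the direction `Z` gives the dual norm bound; the direction `-X` gives the
reverse inequality at `X`. -/
theorem inner_le_nuc_of_mem_regSubdiff (hmn : m ≤ n) {X W : Matrix (Fin m) (Fin n) ℝ}
    (hW : W ∈ regSubdiff nuclearNorm X) : (∀ Z, inner ℝ W Z ≤ nuc Z) ∧ nuc X ≤ inner ℝ W X := by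
  refine ⟨fun Z => inner_le_of_mem_regSubdiff hW (nuclearNorm_eq_coe_nuc X) ?_, ?_⟩
  · filter_upwards [self_mem_nhdsWithin] with t ht
    rw [nuclearNorm_eq_coe_nuc, EReal.coe_le_coe_iff]
    exact nuc_add_smul_le hmn X Z (le_of_lt ht)
  · have : inner ℝ W (-X) ≤ -nuc X := by
      refine inner_le_of_mem_regSubdiff hW (nuclearNorm_eq_coe_nuc X) ?_
      filter_upwards [mem_nhdsWithin_of_mem_nhds (Iic_mem_nhds (zero_lt_one (α := ℝ)))] with t ht
      have h := nuc_one_sub_smul_le hmn X ht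
      have h2 : X + t • -X = (1 - t) • X := by module
      rw [nuclearNorm_eq_coe_nuc, EReal.coe_le_coe_iff, h2]
      linarith
    rw [inner_neg_right] at this
    linarith

theorem mem_regSubdiff_nuclearNorm (hmn : m ≤ n) {X W : Matrix (Fin m) (Fin n) ℝ}
    (h : IsPolarPair X W) : W ∈ regSubdiff nuclearNorm X := by
  obtain ⟨h1, h2⟩ := (isPolarPair_iff hmn).1 h
  refine ⟨EReal.coe_ne_top _, EReal.coe_ne_bot _, fun ε hε => Eventually.of_forall fun Y => ?_⟩
  rw [nuclearNorm_eq_coe_nuc, nuclearNorm_eq_coe_nuc, ← EReal.coe_add, EReal.coe_le_coe_iff,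
    inner_sub_right]
  have := h1.inner_le_nuc hmn Y
  have : 0 ≤ ε * ‖Y - X‖ := by positivity
  linarith

theorem regSubdiff_subset_limSubdiff {E : Type*} [NormedAddCommGroup E] [InnerProductSpace ℝ E]
    (g : E → EReal) (z : E) : regSubdiff g z ⊆ limSubdiff g z := fun v hv =>
  ⟨hv.1, hv.2.1, fun _ => z, fun _ => v, tendsto_const_nhds, tendsto_const_nhds,
    tendsto_const_nhds, fun _ => hv⟩

theorem mem_subdiffNuclear_iff (hmn : m ≤ n) {X W : Matrix (Fin m) (Fin n) ℝ} :
    W ∈ subdiffNuclear X ↔ IsPolarPair X W := by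
  refine ⟨?_, fun h => regSubdiff_subset_limSubdiff _ _ (mem_regSubdiff_nuclearNorm hmn h)⟩
  rintro ⟨-, -, y, w, hy, hgy, hw, hyw⟩
  have h := fun k => inner_le_nuc_of_mem_regSubdiff hmn (hyw k)
  refine (isPolarPair_iff hmn).2 ⟨isContr_of_inner_le_nuc hmn fun Z => ?_, ?_⟩
  · exact le_of_tendsto (hw.inner tendsto_const_nhds) (Eventually.of_forall fun k => (h k).1 Z)
  · simp only [nuclearNorm_eq_coe_nuc] at hgy
    exact le_of_tendsto_of_tendsto (EReal.tendsto_coe.1 hgy) (hw.inner hy)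
      (Eventually.of_forall fun k => (h k).2)

end Polar

/-! ### Subdifferential of the rank. -/

section Rank

open Matrix

variable {m n : ℕ}

theorem eventually_rank_le (X : Matrix (Fin m) (Fin n) ℝ) : ∀ᶠ Y in 𝓝 X, X.rank ≤ Y.rank := by
  let L : Matrix (Fin m) (Fin n) ℝ →ₗ[ℝ]
      (EuclideanSpace ℝ (Fin n) →L[ℝ] EuclideanSpace ℝ (Fin m)) :=
    LinearMap.toContinuousLinearMap.toLinearMap ∘ₗ toEuclideanLin.toLinearMap
  have hL : Continuous L := L.continuous_of_finiteDimensional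
  have hrank : ∀ Y : Matrix (Fin m) (Fin n) ℝ,
      (L Y : EuclideanSpace ℝ (Fin n) →ₗ[ℝ] EuclideanSpace ℝ (Fin m)).rank = Y.rank := by
    intro Y
    have h1 : (L Y : EuclideanSpace ℝ (Fin n) →ₗ[ℝ] EuclideanSpace ℝ (Fin m))
      = toEuclideanLin Y := by ext; simp [L]
    rw [h1, LinearMap.rank, ← Module.finrank_eq_rank, toEuclideanLin, toLpLin_eq_toLin,
      ← rank_eq_finrank_range_toLin]
  have hopen := (isOpen_setOfPred_nat_le_rank (𝕜 := ℝ)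
    (E := EuclideanSpace ℝ (Fin n)) (F := EuclideanSpace ℝ (Fin m)) X.rank).preimage hL
  filter_upwards [hopen.mem_nhds (show _ ≤ _ from (hrank X).ge)] with Y hY
  have hY' : (X.rank : Cardinal) ≤
      (L Y : EuclideanSpace ℝ (Fin n) →ₗ[ℝ] EuclideanSpace ℝ (Fin m)).rank := hY
  rw [hrank] at hY'
  exact_mod_cast hY'

theorem trace_eq_rank_of_mul_self {k : ℕ} {A : Matrix (Fin k) (Fin k) ℝ} (h : A * A = A) :
    A.trace = A.rank := by
  have hid : IsIdempotentElem (toLin' A) := by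
    rw [IsIdempotentElem, Module.End.mul_eq_comp, ← toLin'_mul, h]
  have := (LinearMap.IsIdempotentElem.isProj_range _ hid).trace
  rwa [trace_toLin'_eq] at this

theorem mul_diagonal_mul_diagonal_mul {a b c d : ℕ} {U : Matrix (Fin a) (Fin b) ℝ}
    (hU : Uᵀ * U = 1) (x y : Fin b → ℝ) (B : Matrix (Fin c) (Fin b) ℝ)
    (C : Matrix (Fin d) (Fin b) ℝ) :
    B * diagonal x * Uᵀ * (U * diagonal y * Cᵀ) = B * diagonal (fun i => x i * y i) * Cᵀ := by
  rw [← diagonal_mul_diagonal, Matrix.mul_assoc (B * diagonal x), Matrix.mul_assoc U,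
    ← Matrix.mul_assoc Uᵀ, hU, Matrix.one_mul]
  simp only [Matrix.mul_assoc]

/-- Every matrix has a Moore–Penrose type inverse `A` and a partial isometry `W` with
`WᵀW = AX` that forms a polar pair with it. -/
theorem exists_partialIsometry (hmn : m ≤ n) (X : Matrix (Fin m) (Fin n) ℝ) :
    ∃ (W : Matrix (Fin m) (Fin n) ℝ) (A : Matrix (Fin n) (Fin m) ℝ),
      X * A * X = X ∧ A * X * A = A ∧ Wᵀ * W = A * X ∧ W * Wᵀ * W = W ∧
        IsPolarPair X W := by
  obtain ⟨U, V, hU, hV, hX⟩ := exists_svd hmn X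
  set s := sigma X with hs
  -- Since `0⁻¹ = 0`, this is the indicator of the nonzero singular values.
  let e : Fin m → ℝ := fun i => s i * (s i)⁻¹
  have he : ∀ i, e i * e i = e i := fun i => by
    by_cases h : s i = 0 <;> simp [e, h]
  have hes : ∀ i, e i * s i = s i := fun i => by
    by_cases h : s i = 0 <;> simp [e, h]
  have hesi : ∀ i, e i * (s i)⁻¹ = (s i)⁻¹ := fun i => by
    by_cases h : s i = 0 <;> simp [e, h]
  have hWt : (U * diagonal e * Vᵀ)ᵀ = V * diagonal e * Uᵀ := by
    simp only [transpose_mul, transpose_transpose, diagonal_transpose, Matrix.mul_assoc]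
  refine ⟨U * diagonal e * Vᵀ, V * diagonal (fun i => (s i)⁻¹) * Uᵀ, ?_, ?_, ?_, ?_, ?_, ?_, ?_⟩
  · conv_rhs => rw [hX]
    conv_lhs => rw [hX]
    rw [mul_diagonal_mul_diagonal_mul hV, mul_diagonal_mul_diagonal_mul hU]
    simp only [e] at hes
    simp only [hes]
  · rw [hX, mul_diagonal_mul_diagonal_mul hU, mul_diagonal_mul_diagonal_mul hV]
    simp only [e] at hesi
    simp only [mul_comm _ (s _), hesi]
  · rw [hWt, hX, mul_diagonal_mul_diagonal_mul hU, mul_diagonal_mul_diagonal_mul hU]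
    simp only [he, mul_comm _ (s _), e]
  · rw [hWt, mul_diagonal_mul_diagonal_mul hV, mul_diagonal_mul_diagonal_mul hU]
    simp only [he]
  · have h1 : 1 - (U * diagonal e * Vᵀ)ᵀ * (U * diagonal e * Vᵀ)
        = (1 - V * diagonal e * Vᵀ)ᵀ * (1 - V * diagonal e * Vᵀ) := by
      have h2 : (V * diagonal e * Vᵀ)ᵀ = V * diagonal e * Vᵀ := by
        simp only [transpose_mul, transpose_transpose, diagonal_transpose, Matrix.mul_assoc]
      rw [hWt, mul_diagonal_mul_diagonal_mul hU, transpose_sub, h2, transpose_one, sub_mul,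
        mul_sub, mul_sub, mul_diagonal_mul_diagonal_mul hV, mul_one, one_mul, mul_one]
      simp only [he]
      abel
    unfold IsContr
    rw [h1]
    exact posSemidef_transpose_mul_self _
  · rw [hWt, hX, mul_diagonal_mul_diagonal_mul hU]
    simp only [hes]
    have : (diagonal s).PosSemidef := PosSemidef.diagonal fun i => sigma_nonneg X i
    simpa using PosSemidef.transpose_mul_mul_same' this Vᵀ
  · conv_rhs => rw [hX]
    rw [hWt, mul_diagonal_mul_diagonal_mul hV]
    conv_lhs => rw [hX]
    rw [mul_diagonal_mul_diagonal_mul hU]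
    simp only [he, hes]

theorem trace_transpose_mul_self_eq_rank {X W : Matrix (Fin m) (Fin n) ℝ}
    {A : Matrix (Fin n) (Fin m) ℝ} (h1 : X * A * X = X) (h2 : A * X * A = A)
    (h3 : Wᵀ * W = A * X) : (Wᵀ * W).trace = X.rank := by
  rw [h3, trace_eq_rank_of_mul_self (by rw [← Matrix.mul_assoc, h2])]
  congr 1
  refine le_antisymm (rank_mul_le_right _ _) ?_
  conv_lhs => rw [← h1, Matrix.mul_assoc]
  exact rank_mul_le_right _ _

theorem mul_eq_zero_of_rank_le_rank_mul {a b c : ℕ} {A : Matrix (Fin a) (Fin b) ℝ}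
    {Y : Matrix (Fin b) (Fin c) ℝ} (h : Y.rank ≤ (A * Y).rank) {d : ℕ}
    {Z : Matrix (Fin c) (Fin d) ℝ} (hZ : A * Y * Z = 0) : Y * Z = 0 := by
  have hle : LinearMap.ker Y.mulVecLin ≤ LinearMap.ker (A * Y).mulVecLin := by
    intro x hx
    simp only [LinearMap.mem_ker, mulVecLin_apply, ← mulVec_mulVec] at hx ⊢
    rw [hx, mulVec_zero]
  have h1 := Y.mulVecLin.finrank_range_add_finrank_ker
  have h2 := (A * Y).mulVecLin.finrank_range_add_finrank_ker
  have hker : LinearMap.ker Y.mulVecLin = LinearMap.ker (A * Y).mulVecLin := by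
    refine Submodule.eq_of_le_of_finrank_le hle ?_
    simp only [rank] at h
    omega
  ext i j
  have hmem : Z.col j ∈ LinearMap.ker (A * Y).mulVecLin := by
    rw [LinearMap.mem_ker, mulVecLin_apply]
    ext l
    exact congrFun (congrFun hZ l) j
  rw [← hker, LinearMap.mem_ker, mulVecLin_apply] at hmem
  exact congrFun hmem i

/-- Matrices `H` with `HXᵀ = 0` and `XᵀH = 0` are normal to the set of matrices of rank at
most `rank X` at `X`. -/
theorem mem_regNormalCone_rank_le (hmn : m ≤ n) {X H : Matrix (Fin m) (Fin n) ℝ}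
    (h1 : H * Xᵀ = 0) (h2 : Xᵀ * H = 0) : H ∈ regNormalCone {Y | Y.rank ≤ X.rank} X := by
  refine ⟨le_refl X.rank, fun ε hε => ?_⟩
  obtain ⟨W, A, hA1, hA2, hW, -, -⟩ := exists_partialIsometry hmn X
  have hsym : (A * X)ᵀ = A * X := by rw [← hW, transpose_mul, transpose_transpose]
  set Q := 1 - A * X with hQ
  have hQt : Qᵀ = Q := by rw [hQ, transpose_sub, transpose_one, hsym]
  have hHQ : H * Q = H := by
    rw [hQ, Matrix.mul_sub, Matrix.mul_one, ← hsym, transpose_mul, ← Matrix.mul_assoc, h1,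
      Matrix.zero_mul, sub_zero]
  have hXQ : X * Q = 0 := by
    rw [hQ, Matrix.mul_sub, Matrix.mul_one, ← Matrix.mul_assoc, hA1, sub_self]
  have hHX : Hᵀ * X = 0 := by
    rw [← transpose_transpose (Hᵀ * X), transpose_mul, transpose_transpose, h2, transpose_zero]
  -- `M X = 1`, so `M Y` is invertible near `X`, and `Z = (M Y)⁻¹ Q` tends to `Q`. When `rank Y ≤
  -- rank X`, `Z` will satisfy `Y Z = 0`: it perturbs the kernel projection `Q` of `X` into the
  -- kernel of `Y`.
  let M : Matrix (Fin m) (Fin n) ℝ → Matrix (Fin n) (Fin n) ℝ := fun Y => Q + A * Y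
  have hMX : M X = 1 := by simp [M, hQ]
  have hMc : Continuous M := by fun_prop
  have hdet : ∀ᶠ Y in 𝓝 X, (M Y).det ≠ 0 := by
    have : ContinuousAt (fun Y => (M Y).det) X := hMc.matrix_det.continuousAt
    refine this.eventually_ne ?_
    rw [hMX, det_one]
    exact one_ne_zero
  have hinv : Tendsto (fun Y => Q - (M Y)⁻¹ * Q) (𝓝 X) (𝓝 0) := by
    have h3 : ContinuousAt (fun Y => (M Y)⁻¹) X := by
      have : (fun Y => (M Y)⁻¹) = fun Y => (M Y).det⁻¹ • (M Y).adjugate := by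
        ext1 Y
        rw [inv_def, Ring.inverse_eq_inv']
      rw [this]
      refine ContinuousAt.smul (ContinuousAt.inv₀ hMc.matrix_det.continuousAt ?_)
        hMc.matrix_adjugate.continuousAt
      rw [hMX, det_one]
      exact one_ne_zero
    have h4 : ContinuousAt (fun Y => Q - (M Y)⁻¹ * Q) X :=
      continuousAt_const.sub
        ((continuous_id.matrix_mul continuous_const).continuousAt.comp h3)
    have h5 := h4.tendsto
    rwa [hMX, inv_one, one_mul, sub_self] at h5
  have hrank : ∀ᶠ Y in 𝓝 X, X.rank ≤ (A * Y).rank := by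
    have hc : Continuous fun Y : Matrix (Fin m) (Fin n) ℝ => A * Y := by fun_prop
    filter_upwards [hc.continuousAt.eventually (eventually_rank_le (A * X))] with Y hY
    refine le_trans ?_ hY
    conv_lhs => rw [← hA1, Matrix.mul_assoc]
    exact rank_mul_le_right _ _
  have hsmall : ∀ᶠ Y in 𝓝 X, ‖H‖ * ‖Q - (M Y)⁻¹ * Q‖ < ε := by
    have := hinv.norm.const_mul ‖H‖
    rw [norm_zero, mul_zero] at this
    exact this.eventually (gt_mem_nhds hε)
  filter_upwards [mem_nhdsWithin_of_mem_nhds hdet, mem_nhdsWithin_of_mem_nhds hrank,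
    mem_nhdsWithin_of_mem_nhds hsmall, self_mem_nhdsWithin] with Y hdet hrank hsmall hY
  set Z := (M Y)⁻¹ * Q with hZ
  have hMZ : Q * Z + A * Y * Z = Q := by
    rw [← Matrix.add_mul, hZ, ← Matrix.mul_assoc]
    change M Y * (M Y)⁻¹ * Q = Q
    rw [mul_nonsing_inv _ (isUnit_iff_ne_zero.2 hdet), Matrix.one_mul]
  -- Multiply `Q Z + A Y Z = Q` by `AX`, which kills `Q` and fixes `A`.
  have hAYZ : A * Y * Z = 0 := by
    have h3 : A * X * (Q * Z + A * Y * Z) = A * X * Q := by rw [hMZ]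
    rwa [Matrix.mul_add, ← Matrix.mul_assoc (A * X) Q, Matrix.mul_assoc A X Q, hXQ,
      Matrix.mul_zero, Matrix.zero_mul, zero_add, ← Matrix.mul_assoc (A * X) (A * Y),
      ← Matrix.mul_assoc (A * X) A, hA2] at h3
  have hYZ : Y * Z = 0 := mul_eq_zero_of_rank_le_rank_mul (le_trans hY hrank) hAYZ
  -- Both `Y - X` and `Q - Z` tend to zero, so the pairing with `H` is `o(‖Y - X‖)`.
  have hin : inner ℝ H (Y - X) = inner ℝ H ((Y - X) * (Q - Z)) := by
    have h3 : Hᵀ * ((Y - X) * (Q - Z)) = Hᵀ * Y * Q := by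
      simp only [Matrix.mul_sub, Matrix.sub_mul, hXQ, ← Matrix.mul_assoc, hHX]
      simp only [Matrix.mul_assoc, hYZ, Matrix.mul_zero, Matrix.zero_mul, sub_zero]
    have h4 : (Hᵀ * Y * Q).trace = (Hᵀ * Y).trace := by
      rw [trace_mul_cycle, ← hQt, ← transpose_mul, hHQ]
    rw [inner_eq_trace, inner_eq_trace, h3, h4, Matrix.mul_sub, hHX, sub_zero]
  rw [hin]
  calc inner ℝ H ((Y - X) * (Q - Z)) ≤ ‖H‖ * ‖(Y - X) * (Q - Z)‖ := real_inner_le_norm _ _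
    _ ≤ ‖H‖ * (‖Y - X‖ * ‖Q - Z‖) := by gcongr; exact frobenius_norm_mul _ _
    _ = ‖H‖ * ‖Q - Z‖ * ‖Y - X‖ := by ring
    _ ≤ ε * ‖Y - X‖ := by gcongr

theorem mem_limSubdiff_rankFun (hmn : m ≤ n) {X H : Matrix (Fin m) (Fin n) ℝ}
    (h1 : H * Xᵀ = 0) (h2 : Xᵀ * H = 0) : H ∈ limSubdiff rankFun X := by
  refine regSubdiff_subset_limSubdiff _ _
    ⟨EReal.coe_ne_top _, EReal.coe_ne_bot _, fun ε hε => ?_⟩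
  have hcone := eventually_nhdsWithin_iff.1 ((mem_regNormalCone_rank_le hmn h1 h2).2 ε hε)
  have hsmall : ∀ᶠ Y in 𝓝 X, inner ℝ H (Y - X) < 1 := by
    have hc : Continuous fun Y : Matrix (Fin m) (Fin n) ℝ => (inner ℝ H (Y - X) : ℝ) := by
      fun_prop
    have := hc.tendsto X
    rw [sub_self, inner_zero_right] at this
    exact this.eventually (gt_mem_nhds one_pos)
  filter_upwards [hcone, hsmall, eventually_rank_le X] with Y hY hs hr
  unfold rankFun
  rw [← EReal.coe_add, EReal.coe_le_coe_iff]
  have hn : 0 ≤ ε * ‖Y - X‖ := by positivity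
  -- Either the rank jumps by at least `1`, which absorbs the small linear term, or `Y` lies in the
  -- set where the normal cone bound applies.
  rcases Nat.lt_or_ge X.rank Y.rank with h | h
  · have : (X.rank : ℝ) + 1 ≤ Y.rank := by exact_mod_cast h
    linarith
  · have : (X.rank : ℝ) ≤ Y.rank := by exact_mod_cast hr
    linarith [hY h]

/-- The lines `(1 + t HXᵀ) X` and `X (1 + t XᵀH)` never exceed the rank of `X`, and `H` pairs with
their directions to `‖HXᵀ‖²` and `‖XᵀH‖²`. -/
theorem mul_transpose_eq_zero_of_mem_regSubdiff_rankFun {X H : Matrix (Fin m) (Fin n) ℝ}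
    (hH : H ∈ regSubdiff rankFun X) : H * Xᵀ = 0 ∧ Xᵀ * H = 0 := by
  have hcone := mem_regNormalCone_sublevel hH
  have hmem : ∀ {Y : Matrix (Fin m) (Fin n) ℝ}, Y.rank ≤ X.rank →
      Y ∈ {Y | rankFun Y ≤ rankFun X} := by
    intro Y hY
    change ((Y.rank : ℝ) : EReal) ≤ ((X.rank : ℝ) : EReal)
    exact_mod_cast hY
  have hline : ∀ D : Matrix (Fin m) (Fin n) ℝ, HasDerivAt (fun t : ℝ => X + t • D) D 0 := by
    intro D
    have h := ((hasDerivAt_id (0 : ℝ)).smul_const D).const_add X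
    rwa [one_smul] at h
  constructor
  · have h := inner_eq_zero_of_mem_regNormalCone hcone (hline (H * Xᵀ * X)) (by simp) fun t =>
      hmem (by
        have : X + t • (H * Xᵀ * X) = (1 + t • (H * Xᵀ)) * X := by
          rw [Matrix.add_mul, Matrix.one_mul, Matrix.smul_mul]
        rw [this]
        exact rank_mul_le_right _ _)
    have h2 : inner ℝ H (H * Xᵀ * X) = ((H * Xᵀ)ᵀ * (H * Xᵀ)).trace := by
      rw [inner_eq_trace, transpose_mul, transpose_transpose, ← Matrix.mul_assoc, trace_mul_comm,
        ← Matrix.mul_assoc]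
    exact eq_zero_of_trace_transpose_mul_self (h2.symm.trans h)
  · have h := inner_eq_zero_of_mem_regNormalCone hcone (hline (X * (Xᵀ * H))) (by simp) fun t =>
      hmem (by
        have : X + t • (X * (Xᵀ * H)) = X * (1 + t • (Xᵀ * H)) := by
          rw [Matrix.mul_add, Matrix.mul_one, Matrix.mul_smul]
        rw [this]
        exact rank_mul_le_left _ _)
    have h2 : inner ℝ H (X * (Xᵀ * H)) = ((Xᵀ * H)ᵀ * (Xᵀ * H)).trace := by
      rw [inner_eq_trace, transpose_mul, transpose_transpose, ← Matrix.mul_assoc]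
    exact eq_zero_of_trace_transpose_mul_self (h2.symm.trans h)

theorem mul_transpose_eq_zero_of_mem_limSubdiff_rankFun {X H : Matrix (Fin m) (Fin n) ℝ}
    (hH : H ∈ limSubdiff rankFun X) : H * Xᵀ = 0 ∧ Xᵀ * H = 0 := by
  obtain ⟨-, -, y, w, hy, -, hw, hyw⟩ := hH
  have h := fun k => mul_transpose_eq_zero_of_mem_regSubdiff_rankFun (hyw k)
  have hc1 : Continuous fun p : Matrix (Fin m) (Fin n) ℝ × Matrix (Fin m) (Fin n) ℝ =>
      p.2 * p.1ᵀ := by fun_prop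
  have hc2 : Continuous fun p : Matrix (Fin m) (Fin n) ℝ × Matrix (Fin m) (Fin n) ℝ =>
      p.1ᵀ * p.2 := by fun_prop
  have ht := hy.prodMk_nhds hw
  constructor
  · refine tendsto_nhds_unique ((hc1.tendsto _).comp ht) ?_
    simp [Function.comp_def, (h _).1]
  · refine tendsto_nhds_unique ((hc2.tendsto _).comp ht) ?_
    simp [Function.comp_def, (h _).2]

end Rank

/-! ### Normals to the graph of `∂‖·‖_*`, and the inclusion of the coderivative in `∂rank`. -/

section Coderivative

open Matrix

variable {m n : ℕ}

theorem hasDerivAt_toLp {E G : Type*} [NormedAddCommGroup E] [InnerProductSpace ℝ E]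
    [NormedAddCommGroup G] [InnerProductSpace ℝ G] {a : ℝ → E} {b : ℝ → G} {a' : E} {b' : G}
    {t : ℝ} (ha : HasDerivAt a a' t) (hb : HasDerivAt b b' t) :
    HasDerivAt (fun s => WithLp.toLp 2 (a s, b s)) (WithLp.toLp 2 (a', b')) t :=
  ((WithLp.prodContinuousLinearEquiv 2 ℝ E G).symm.toContinuousLinearMap.hasFDerivAt).comp_hasDerivAt
    t (ha.prodMk hb)

theorem inner_add_inner_eq_zero_of_mem_regNormalCone (hmn : m ≤ n)
    {p q : WithLp 2 (Matrix (Fin m) (Fin n) ℝ × Matrix (Fin m) (Fin n) ℝ)}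
    (hq : q ∈ regNormalCone (graph subdiffNuclear) p)
    {a b : ℝ → Matrix (Fin m) (Fin n) ℝ} {a' b' : Matrix (Fin m) (Fin n) ℝ}
    (ha : HasDerivAt a a' 0) (hb : HasDerivAt b b' 0) (ha0 : a 0 = p.fst) (hb0 : b 0 = p.snd)
    (h : ∀ t, IsPolarPair (a t) (b t)) : inner ℝ q.fst a' + inner ℝ q.snd b' = 0 := by
  have := inner_eq_zero_of_mem_regNormalCone hq (hasDerivAt_toLp ha hb) (by rw [ha0, hb0]; rfl)
    fun t => (mem_subdiffNuclear_iff hmn).2 (h t)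
  rwa [WithLp.prod_inner_apply] at this

theorem IsPolarPair.mul_left {X W : Matrix (Fin m) (Fin n) ℝ} (h : IsPolarPair X W)
    {P : Matrix (Fin m) (Fin m) ℝ} (hP : Pᵀ * P = 1) : IsPolarPair (P * X) (P * W) := by
  have h1 : ∀ Y : Matrix (Fin m) (Fin n) ℝ, (P * W)ᵀ * (P * Y) = Wᵀ * Y := by
    intro Y
    rw [transpose_mul, Matrix.mul_assoc, ← Matrix.mul_assoc Pᵀ, hP, Matrix.one_mul]
  refine ⟨?_, ?_, ?_⟩
  · unfold IsContr
    rw [h1]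
    exact h.1
  · rw [h1]
    exact h.2.1
  · rw [Matrix.mul_assoc, h1, Matrix.mul_assoc, ← Matrix.mul_assoc W, h.2.2]

theorem IsPolarPair.mul_right {X W : Matrix (Fin m) (Fin n) ℝ} (h : IsPolarPair X W)
    {Q : Matrix (Fin n) (Fin n) ℝ} (hQ : Q * Qᵀ = 1) : IsPolarPair (X * Q) (W * Q) := by
  have h1 : ∀ Y : Matrix (Fin m) (Fin n) ℝ, (W * Q)ᵀ * (Y * Q) = Qᵀ * (Wᵀ * Y) * Q := by
    intro Y
    simp only [transpose_mul, Matrix.mul_assoc]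
  have hQ' : Qᵀ * Q = 1 := mul_eq_one_comm.1 hQ
  refine ⟨?_, ?_, ?_⟩
  · have h2 : 1 - (W * Q)ᵀ * (W * Q) = Qᵀ * (1 - Wᵀ * W) * Q := by
      rw [h1, Matrix.mul_sub, Matrix.sub_mul, Matrix.mul_one, hQ']
    unfold IsContr
    rw [h2]
    exact PosSemidef.transpose_mul_mul_same' h.1 Q
  · rw [h1]
    exact PosSemidef.transpose_mul_mul_same' h.2.1 Q
  · have h2 : W * Q * (W * Q)ᵀ = W * Wᵀ := by
      rw [transpose_mul, Matrix.mul_assoc, ← Matrix.mul_assoc Q, hQ, Matrix.one_mul]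
    rw [h2, ← Matrix.mul_assoc, h.2.2]

theorem IsPolarPair.transpose_mul_mul {X W : Matrix (Fin m) (Fin n) ℝ} (h : IsPolarPair X W) :
    Wᵀ * W * (Wᵀ * X) = Wᵀ * X := by
  rw [Matrix.mul_assoc, ← Matrix.mul_assoc W, h.2.2]

/-- Moving the positive semidefinite factor `P = WᵀX` along `(1 + tPT) P (1 + tTP)`. -/
theorem IsPolarPair.congr {X W : Matrix (Fin m) (Fin n) ℝ} (h : IsPolarPair X W)
    {T : Matrix (Fin n) (Fin n) ℝ} (hT : Tᵀ = T) (t : ℝ) :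
    IsPolarPair (W * ((1 + t • (Wᵀ * X * T)) * (Wᵀ * X) * (1 + t • (T * (Wᵀ * X))))) W := by
  set P := Wᵀ * X with hP
  have hPt : Pᵀ = P := transpose_eq_of_posSemidef h.2.1
  have h0 : Wᵀ * W * P = P := h.transpose_mul_mul
  have h1 : Wᵀ * (W * ((1 + t • (P * T)) * P * (1 + t • (T * P))))
      = (1 + t • (P * T)) * P * (1 + t • (T * P)) := by
    have h2 : Wᵀ * W * ((1 + t • (P * T)) * P) = (1 + t • (P * T)) * P := by
      rw [Matrix.add_mul, Matrix.one_mul, Matrix.mul_add, h0, Matrix.smul_mul, Matrix.mul_smul,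
        Matrix.mul_assoc P, ← Matrix.mul_assoc (Wᵀ * W), h0]
    rw [← Matrix.mul_assoc, ← Matrix.mul_assoc, h2]
  refine ⟨h.1, ?_, ?_⟩
  · rw [h1]
    have h3 : 1 + t • (P * T) = (1 + t • (T * P))ᵀ := by
      rw [transpose_add, transpose_one, transpose_smul, transpose_mul, hT, hPt]
    rw [h3]
    exact PosSemidef.transpose_mul_mul_same' h.2.1 _
  · rw [Matrix.mul_assoc, h1]

theorem hasDerivAt_polar_curve {X W : Matrix (Fin m) (Fin n) ℝ} (h : IsPolarPair X W)
    (T : Matrix (Fin n) (Fin n) ℝ) :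
    HasDerivAt (fun t : ℝ =>
      W * ((1 + t • (Wᵀ * X * T)) * (Wᵀ * X) * (1 + t • (T * (Wᵀ * X)))))
      ((2 : ℝ) • (X * T * (Wᵀ * X))) 0 := by
  set P := Wᵀ * X with hP
  have hWP : ∀ B : Matrix (Fin n) (Fin n) ℝ, W * (P * B) = X * B := by
    intro B
    rw [hP, ← Matrix.mul_assoc, ← Matrix.mul_assoc, h.2.2]
  have h1 : ∀ t : ℝ, W * ((1 + t • (P * T)) * P * (1 + t • (T * P)))
      = X + t • ((2 : ℝ) • (X * T * P)) + (t * t) • (X * T * P * T * P) := by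
    intro t
    have h2 : (1 + t • (P * T)) * P * (1 + t • (T * P))
        = P * (1 + t • ((2 : ℝ) • (T * P)) + (t * t) • (T * P * T * P)) := by
      simp only [Matrix.add_mul, Matrix.mul_add, Matrix.one_mul, Matrix.mul_one, Matrix.smul_mul,
        Matrix.mul_smul, Matrix.mul_assoc]
      module
    rw [h2, hWP, Matrix.mul_add, Matrix.mul_add, Matrix.mul_one, Matrix.mul_smul, Matrix.mul_smul,
      Matrix.mul_smul]
    simp only [Matrix.mul_assoc]
  simp only [h1]
  have hd := (((hasDerivAt_id (0 : ℝ)).smul_const ((2 : ℝ) • (X * T * P))).const_add X).add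
    (((hasDerivAt_id (0 : ℝ)).mul (hasDerivAt_id (0 : ℝ))).smul_const (X * T * P * T * P))
  convert! hd using 1
  simp

theorem symm_of_mem_regNormalCone_graph (hmn : m ≤ n)
    {p q : WithLp 2 (Matrix (Fin m) (Fin n) ℝ × Matrix (Fin m) (Fin n) ℝ)}
    (hq : q ∈ regNormalCone (graph subdiffNuclear) p) :
    (p.fst * q.fstᵀ + p.snd * q.sndᵀ)ᵀ = p.fst * q.fstᵀ + p.snd * q.sndᵀ ∧
    (q.fstᵀ * p.fst + q.sndᵀ * p.snd)ᵀ = q.fstᵀ * p.fst + q.sndᵀ * p.snd := by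
  have hp : IsPolarPair p.fst p.snd := (mem_subdiffNuclear_iff hmn).1 hq.1
  constructor <;> refine transpose_eq_of_trace_rotGen_mul fun i j hij => ?_
  · have h := inner_add_inner_eq_zero_of_mem_regNormalCone hmn hq (hasDerivAt_rot_mul i j p.fst)
      (hasDerivAt_rot_mul i j p.snd) (by simp) (by simp)
      fun t => hp.mul_left (rot_transpose_mul_self hij t)
    rw [inner_eq_trace, inner_eq_trace, trace_mul_comm, trace_mul_comm q.sndᵀ] at h
    rw [Matrix.mul_add, trace_add, ← Matrix.mul_assoc, ← Matrix.mul_assoc, h]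
  · have h := inner_add_inner_eq_zero_of_mem_regNormalCone hmn hq (hasDerivAt_mul_rot i j p.fst)
      (hasDerivAt_mul_rot i j p.snd) (by simp) (by simp)
      fun t => hp.mul_right (rot_mul_transpose_self hij t)
    rw [inner_eq_trace, inner_eq_trace, ← Matrix.mul_assoc, ← Matrix.mul_assoc, trace_mul_comm,
      trace_mul_comm (q.sndᵀ * p.snd)] at h
    rw [Matrix.mul_add, trace_add, h]

theorem inner_eq_zero_of_mem_regNormalCone_graph (hmn : m ≤ n)
    {p q : WithLp 2 (Matrix (Fin m) (Fin n) ℝ × Matrix (Fin m) (Fin n) ℝ)}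
    (hq : q ∈ regNormalCone (graph subdiffNuclear) p) {T : Matrix (Fin n) (Fin n) ℝ}
    (hT : Tᵀ = T) : inner ℝ q.fst (p.fst * T * (p.sndᵀ * p.fst)) = 0 := by
  have hp : IsPolarPair p.fst p.snd := (mem_subdiffNuclear_iff hmn).1 hq.1
  have h := inner_add_inner_eq_zero_of_mem_regNormalCone hmn hq
    (hasDerivAt_polar_curve hp T) (hasDerivAt_const 0 p.snd)
    (by simp [← Matrix.mul_assoc, hp.2.2]) rfl (fun t => hp.congr hT t)
  rw [inner_zero_right, add_zero, inner_smul_right] at h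
  linarith

/-- Rotating `W` on either side keeps `σ(W)`, so these curves stay in the sublevel set of `Φ̂ ∘ σ`.
-/
theorem symm_of_mem_regSubdiff_PhiHat {φ : ℝ → EReal} {W D : Matrix (Fin m) (Fin n) ℝ}
    (hD : D ∈ regSubdiff (fun Y => PhiHat φ (sigma Y)) W) :
    (W * Dᵀ)ᵀ = W * Dᵀ ∧ (Dᵀ * W)ᵀ = Dᵀ * W := by
  have hcone := mem_regNormalCone_sublevel hD
  have hmem : ∀ {Y : Matrix (Fin m) (Fin n) ℝ}, sigma Y = sigma W →
      Y ∈ {Y | PhiHat φ (sigma Y) ≤ PhiHat φ (sigma W)} := by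
    intro Y hY
    change PhiHat φ (sigma Y) ≤ PhiHat φ (sigma W)
    rw [hY]
  constructor <;> refine transpose_eq_of_trace_rotGen_mul fun i j hij => ?_
  · have h := inner_eq_zero_of_mem_regNormalCone hcone (hasDerivAt_rot_mul i j W) (by simp)
      fun t => hmem (sigma_mul_left (rot_transpose_mul_self hij t) W)
    rwa [inner_eq_trace, trace_mul_comm, Matrix.mul_assoc] at h
  · have h := inner_eq_zero_of_mem_regNormalCone hcone (hasDerivAt_mul_rot i j W) (by simp)
      fun t => hmem (sigma_mul_right (rot_mul_transpose_self hij t) W)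
    rwa [inner_eq_trace, ← Matrix.mul_assoc, trace_mul_comm] at h

theorem symm_of_mem_limSubdiff_PhiHat {φ : ℝ → EReal} {W D : Matrix (Fin m) (Fin n) ℝ}
    (hD : D ∈ limSubdiff (fun Y => PhiHat φ (sigma Y)) W) :
    (W * Dᵀ)ᵀ = W * Dᵀ ∧ (Dᵀ * W)ᵀ = Dᵀ * W := by
  obtain ⟨-, -, y, w, hy, -, hw, hyw⟩ := hD
  have h := fun k => symm_of_mem_regSubdiff_PhiHat (hyw k)
  have hc1 : Continuous fun p : Matrix (Fin m) (Fin n) ℝ × Matrix (Fin m) (Fin n) ℝ =>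
      (p.1 * p.2ᵀ)ᵀ - p.1 * p.2ᵀ := by fun_prop
  have hc2 : Continuous fun p : Matrix (Fin m) (Fin n) ℝ × Matrix (Fin m) (Fin n) ℝ =>
      (p.2ᵀ * p.1)ᵀ - p.2ᵀ * p.1 := by fun_prop
  have ht := hy.prodMk_nhds hw
  constructor
  · refine sub_eq_zero.1 (tendsto_nhds_unique ((hc1.tendsto _).comp ht) ?_)
    exact tendsto_const_nhds.congr fun k => (sub_eq_zero.2 (h k).1).symm
  · refine sub_eq_zero.1 (tendsto_nhds_unique ((hc2.tendsto _).comp ht) ?_)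
    exact tendsto_const_nhds.congr fun k => (sub_eq_zero.2 (h k).2).symm

/-- With `B = XᵀH` symmetric, the inner product is `tr(BPB)`, so `PB = 0`. As `P² = XᵀX`, this gives
`XB = 0`, then `B = 0`; symmetry of `XHᵀ` turns `‖HXᵀ‖²` into a trace containing `HᵀX = B`. -/
theorem eq_zero_of_symm_of_inner_eq_zero {X W H : Matrix (Fin m) (Fin n) ℝ}
    (hXW : IsPolarPair X W) (h1 : (X * Hᵀ)ᵀ = X * Hᵀ) (h2 : (Hᵀ * X)ᵀ = Hᵀ * X)
    (h3 : inner ℝ H (X * (Xᵀ * H) * (Wᵀ * X)) = 0) : H * Xᵀ = 0 ∧ Xᵀ * H = 0 := by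
  obtain ⟨-, hP, hWX⟩ := hXW
  rw [transpose_mul, transpose_transpose] at h1 h2
  set P := Wᵀ * X with hPdef
  have hPt : Pᵀ = P := transpose_eq_of_posSemidef hP
  have hPX : P * P = Xᵀ * X := by
    calc P * P = Pᵀ * P := by rw [hPt]
      _ = Xᵀ * (W * Wᵀ * X) := by
        simp only [hPdef, transpose_mul, transpose_transpose, Matrix.mul_assoc]
      _ = Xᵀ * X := by rw [hWX]
  have hB : (Xᵀ * H)ᵀ = Xᵀ * H := by rw [transpose_mul, transpose_transpose, h2]
  have hPB : P * (Xᵀ * H) = 0 := by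
    refine mul_eq_zero_of_trace_nonpos hP (le_of_eq ?_)
    calc ((Xᵀ * H)ᵀ * P * (Xᵀ * H)).trace = (Xᵀ * H * (Xᵀ * H)ᵀ * P).trace :=
          trace_mul_cycle _ _ _
      _ = ((Xᵀ * H)ᵀ * (Xᵀ * H) * P).trace := by rw [hB]
      _ = (Hᵀ * (X * (Xᵀ * H) * P)).trace := by
        rw [transpose_mul, transpose_transpose]
        simp only [Matrix.mul_assoc]
      _ = 0 := h3
  have hXXH : X * (Xᵀ * H) = 0 := by
    apply eq_zero_of_trace_transpose_mul_self
    rw [transpose_mul, Matrix.mul_assoc, ← Matrix.mul_assoc Xᵀ X, ← hPX, Matrix.mul_assoc P, hPB]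
    simp
  have hXH : Xᵀ * H = 0 := by
    apply eq_zero_of_trace_transpose_mul_self
    rw [transpose_mul, transpose_transpose, Matrix.mul_assoc, hXXH]
    simp
  refine ⟨?_, hXH⟩
  apply eq_zero_of_trace_transpose_mul_self
  have h4 : (H * Xᵀ)ᵀ * (H * Xᵀ) = X * (Hᵀ * X * Hᵀ) := by
    rw [transpose_mul, transpose_transpose, h1]
    simp only [Matrix.mul_assoc]
  rw [h4, ← h2, hXH]
  simp

theorem coderivative_subset_limSubdiff_rankFun (hmn : m ≤ n) {φ : ℝ → EReal}
    {X W D : Matrix (Fin m) (Fin n) ℝ}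
    (hD : D ∈ limSubdiff (fun Y => PhiHat φ (sigma Y)) W) :
    coderivative subdiffNuclear X W D ⊆ limSubdiff rankFun X := by
  rintro H ⟨hXW, y, w, -, hy, hw, hyw⟩
  have hXW' : IsPolarPair X W := (mem_subdiffNuclear_iff hmn).1 hXW
  have hy1 : Tendsto (fun k => (y k).fst) atTop (𝓝 X) :=
    ((WithLp.prod_continuous_ofLp 2 _ _).fst.tendsto _).comp hy
  have hy2 : Tendsto (fun k => (y k).snd) atTop (𝓝 W) :=
    ((WithLp.prod_continuous_ofLp 2 _ _).snd.tendsto _).comp hy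
  have hw1 : Tendsto (fun k => (w k).fst) atTop (𝓝 H) :=
    ((WithLp.prod_continuous_ofLp 2 _ _).fst.tendsto _).comp hw
  have hw2 : Tendsto (fun k => (w k).snd) atTop (𝓝 (-D)) :=
    ((WithLp.prod_continuous_ofLp 2 _ _).snd.tendsto _).comp hw
  obtain ⟨hs1, hs2⟩ := symm_of_mem_limSubdiff_PhiHat hD
  have h := fun k => symm_of_mem_regNormalCone_graph hmn (hyw k)
  have ht := (hy1.prodMk_nhds hy2).prodMk_nhds (hw1.prodMk_nhds hw2)
  have h1 : (X * Hᵀ)ᵀ = X * Hᵀ := by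
    have hc : Continuous fun p : (Matrix (Fin m) (Fin n) ℝ × Matrix (Fin m) (Fin n) ℝ) ×
        (Matrix (Fin m) (Fin n) ℝ × Matrix (Fin m) (Fin n) ℝ) =>
        (p.1.1 * p.2.1ᵀ + p.1.2 * p.2.2ᵀ)ᵀ - (p.1.1 * p.2.1ᵀ + p.1.2 * p.2.2ᵀ) := by fun_prop
    have h0 := tendsto_nhds_unique ((hc.tendsto _).comp ht)
      (tendsto_const_nhds.congr fun k => (sub_eq_zero.2 (h k).1).symm)
    simp only [transpose_add, transpose_neg, Matrix.mul_neg, hs1] at h0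
    rw [← sub_eq_zero, ← h0]
    abel
  have h2 : (Hᵀ * X)ᵀ = Hᵀ * X := by
    have hc : Continuous fun p : (Matrix (Fin m) (Fin n) ℝ × Matrix (Fin m) (Fin n) ℝ) ×
        (Matrix (Fin m) (Fin n) ℝ × Matrix (Fin m) (Fin n) ℝ) =>
        (p.2.1ᵀ * p.1.1 + p.2.2ᵀ * p.1.2)ᵀ - (p.2.1ᵀ * p.1.1 + p.2.2ᵀ * p.1.2) := by fun_prop
    have h0 := tendsto_nhds_unique ((hc.tendsto _).comp ht)
      (tendsto_const_nhds.congr fun k => (sub_eq_zero.2 (h k).2).symm)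
    simp only [transpose_add, transpose_neg, Matrix.neg_mul, hs2] at h0
    rw [← sub_eq_zero, ← h0]
    abel
  have hB : (Xᵀ * H)ᵀ = Xᵀ * H := by
    rw [transpose_mul, transpose_transpose, ← h2, transpose_mul, transpose_transpose]
  -- The fixed matrix `T = XᵀH` of the limit is symmetric, hence an admissible direction at every
  -- point of the approximating sequence.
  have h3 : inner ℝ H (X * (Xᵀ * H) * (Wᵀ * X)) = 0 := by
    have hc : Continuous fun p : Matrix (Fin m) (Fin n) ℝ × Matrix (Fin m) (Fin n) ℝ =>
        p.1 * (Xᵀ * H) * (p.2ᵀ * p.1) := by fun_prop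
    have hlim : Tendsto (fun k => inner ℝ (w k).fst
        ((y k).fst * (Xᵀ * H) * ((y k).snd.transpose * (y k).fst))) atTop
        (𝓝 (inner ℝ H (X * (Xᵀ * H) * (Wᵀ * X)))) :=
      hw1.inner ((hc.tendsto (X, W)).comp (hy1.prodMk_nhds hy2))
    simp only [inner_eq_zero_of_mem_regNormalCone_graph hmn (hyw _) hB] at hlim
    exact tendsto_nhds_unique hlim tendsto_const_nhds
  obtain ⟨h4, h5⟩ := eq_zero_of_symm_of_inner_eq_zero hXW' h1 h2 h3
  exact mem_limSubdiff_rankFun hmn h4 h5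

end Coderivative

theorem ereal_coe_sum {ι : Type*} (s : Finset ι) (g : ι → ℝ) :
    ((∑ i ∈ s, g i : ℝ) : EReal) = ∑ i ∈ s, (g i : EReal) := by
  classical
  induction s using Finset.induction_on with
  | empty => simp
  | insert i s hi ih => rw [Finset.sum_insert hi, Finset.sum_insert hi, EReal.coe_add, ih]

/-! ### Supporting lines for `φ`. -/

section ClassL

variable {φ : ℝ → EReal}

theorem IsClassL.exists_eq_coe (hφ : IsClassL φ) {s : ℝ} (hs : φ s ≠ ⊤) : ∃ q : ℝ, φ s = q :=
  ⟨(φ s).toReal, (EReal.coe_toReal hs (hφ.ne_bot s)).symm⟩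

theorem IsClassL.map_combo_le (hφ : IsClassL φ) {a b p q θ : ℝ} (hp : φ a = p) (hq : φ b = q)
    (h0 : 0 ≤ θ) (h1 : θ ≤ 1) :
    φ ((1 - θ) * a + θ * b) ≤ (((1 - θ) * p + θ * q : ℝ) : EReal) := by
  have := hφ.convex (x := (a, p)) hp.le (y := (b, q)) hq.le (sub_nonneg.2 h1) h0 (by ring)
  simpa using this

/-- Although `φ̂` need not be convex on the line, it is convex on each closed half-line from `0`.
Moving from `t` towards the point of modulus `s` on the same side gives this inequality. -/
theorem IsClassL.sub_le_of_mem_regSubdiff (hφ : IsClassL φ) {w t p q s : ℝ}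
    (hw : w ∈ regSubdiff (hat φ) t) (hp : hat φ t = p) (hs : 0 ≤ s) (hq : φ s = q) :
    p - |w| * abs (s - |t|) ≤ q := by
  obtain ⟨e, he, het⟩ : ∃ e : ℝ, |e| = 1 ∧ t = e * |t| := by
    rcases le_total 0 t with h | h
    · exact ⟨1, by simp, by simp [abs_of_nonneg h]⟩
    · exact ⟨-1, by simp, by simp [abs_of_nonpos h]⟩
  have key : inner ℝ w (e * (s - |t|)) ≤ q - p := by
    refine inner_le_of_mem_regSubdiff hw hp ?_
    filter_upwards [self_mem_nhdsWithin,
      mem_nhdsWithin_of_mem_nhds (Iic_mem_nhds (zero_lt_one (α := ℝ)))] with θ h0 h1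
    have h0' : (0 : ℝ) ≤ θ := le_of_lt h0
    have h1' : θ ≤ 1 := h1
    have habs : abs (t + θ • (e * (s - |t|))) = (1 - θ) * |t| + θ * s := by
      have : t + θ • (e * (s - |t|)) = e * ((1 - θ) * |t| + θ * s) := by
        rw [smul_eq_mul]
        linear_combination het
      rw [this, abs_mul, he, one_mul, abs_of_nonneg]
      have := mul_nonneg (sub_nonneg.2 h1') (abs_nonneg t)
      positivity
    have h2 := hφ.map_combo_le (a := |t|) hp hq h0' h1'
    unfold hat
    rw [habs]
    refine h2.trans (EReal.coe_le_coe_iff.2 (le_of_eq ?_))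
    ring
  have h3 : inner ℝ w (e * (s - |t|)) = w * (e * (s - |t|)) := by
    simp [mul_comm]
  have h4 : abs (w * (e * (s - |t|))) = |w| * abs (s - |t|) := by rw [abs_mul, abs_mul, he, one_mul]
  have h5 := neg_abs_le (w * (e * (s - |t|)))
  linarith

/-- Apply the previous inequality to regular subgradients tending to `0` at points tending to `0`;
the slope term disappears in the limit. -/
theorem IsClassL.map_zero_le (hφ : IsClassL φ) (h0 : (0 : ℝ) ∈ limSubdiff (hat φ) 0) {s : ℝ}
    (hs : 0 ≤ s) : φ 0 ≤ φ s := by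
  by_cases hq : φ s = ⊤
  · rw [hq]
    exact le_top
  obtain ⟨q, hq⟩ := hφ.exists_eq_coe hq
  obtain ⟨hfin, -, y, w, hy, hgy, hw, hyw⟩ := h0
  have hhat0 : hat φ 0 = φ 0 := by simp [hat]
  rw [hhat0] at hfin hgy
  obtain ⟨p, hp⟩ := hφ.exists_eq_coe hfin
  choose r hr using fun k => hφ.exists_eq_coe (s := |y k|) (hyw k).1
  have hle := fun k => hφ.sub_le_of_mem_regSubdiff (hyw k) (hr k) hs hq
  have hr' : Tendsto r atTop (𝓝 p) := by
    rw [← EReal.tendsto_coe, ← hp]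
    exact hgy.congr hr
  have hlim : Tendsto (fun k => r k - |w k| * abs (s - |y k|)) atTop (𝓝 (p - |0| * abs (s - |0|))) :=
    hr'.sub (hw.abs.mul (tendsto_const_nhds.sub hy.abs).abs)
  have := le_of_tendsto hlim (Eventually.of_forall hle)
  rw [hp, hq, EReal.coe_le_coe_iff]
  simpa using this

theorem IsClassL.map_zero (hφ : IsClassL φ) (h0 : (0 : ℝ) ∈ limSubdiff (hat φ) 0) : φ 0 = 0 := by
  obtain ⟨t, ht0, -, hmin, ht⟩ := hφ.argmin
  refine le_antisymm (ht ▸ hφ.map_zero_le h0 ht0) ?_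
  rw [← ht]
  exact hmin (by simp)

/-- `c` is the supremum of the chord slopes at `1` from points of `[0, 1)`. The chord from `0` has
slope `1`, so `c ≥ 1`; convexity bounds these slopes by those to the right, available because `φ` is
finite slightly beyond `1`. -/
theorem IsClassL.exists_subgradient_one (hφ : IsClassL φ) (h0 : φ 0 = 0) :
    ∃ c : ℝ, 1 ≤ c ∧ ∀ s, 0 ≤ s → ((1 + c * (s - 1) : ℝ) : EReal) ≤ φ s := by
  let S : Set ℝ := {x | ∃ s q : ℝ, 0 ≤ s ∧ s < 1 ∧ φ s = q ∧ x = (1 - q) / (1 - s)}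
  have hcross : ∀ x ∈ S, ∀ u r : ℝ, 1 < u → φ u = r → x ≤ (r - 1) / (u - 1) := by
    rintro x ⟨s, q, hs0, hs1, hq, rfl⟩ u r hu hr
    have hus : 0 < u - s := by linarith
    have h := hφ.map_combo_le (θ := (1 - s) / (u - s)) hq hr
      (div_nonneg (by linarith) hus.le) ((div_le_one hus).2 (by linarith))
    have h1 : (1 - (1 - s) / (u - s)) * s + (1 - s) / (u - s) * u = 1 := by
      field_simp
      ring
    rw [h1, hφ.map_one, ← EReal.coe_one, EReal.coe_le_coe_iff] at h
    have h2 : (1 - (1 - s) / (u - s)) * q + (1 - s) / (u - s) * r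
        = ((u - 1) * q + (1 - s) * r) / (u - s) := by
      field_simp
      ring
    rw [h2, le_div_iff₀ hus] at h
    rw [div_le_div_iff₀ (by linarith) (by linarith)]
    linarith
  have h1S : (1 : ℝ) ∈ S := ⟨0, 0, le_rfl, one_pos, by simpa using h0, by simp⟩
  have hbdd : BddAbove S := by
    have hnhds : ∀ᶠ t in 𝓝 (1 : ℝ), φ t < ⊤ := mem_interior_iff_mem_nhds.1 (hφ.dom (by simp))
    obtain ⟨u, hu, hu1⟩ := ((hnhds.filter_mono nhdsWithin_le_nhds).and
      (self_mem_nhdsWithin : Set.Ioi (1 : ℝ) ∈ 𝓝[>] 1)).exists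
    obtain ⟨r, hr⟩ := hφ.exists_eq_coe (s := u) (ne_of_lt hu)
    exact ⟨_, fun x hx => hcross x hx u r hu1 hr⟩
  refine ⟨sSup S, le_csSup hbdd h1S, fun s hs => ?_⟩
  by_cases hq : φ s = ⊤
  · rw [hq]
    exact le_top
  obtain ⟨q, hq⟩ := hφ.exists_eq_coe hq
  rw [hq, EReal.coe_le_coe_iff]
  rcases lt_trichotomy s 1 with h | rfl | h
  · have := le_csSup hbdd ⟨s, q, hs, h, hq, rfl⟩
    rw [div_le_iff₀ (by linarith)] at this
    linarith
  · have : (q : EReal) = (1 : ℝ) := by rw [← hq, hφ.map_one, EReal.coe_one]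
    rw [EReal.coe_eq_coe_iff] at this
    simp [this]
  · have := csSup_le ⟨1, h1S⟩ fun x hx => hcross x hx s q h hq
    rw [le_div_iff₀ (by linarith)] at this
    linarith

end ClassL

/-! ### The partial isometry as multiplier: subgradient and coderivative. -/

section PartialIsometry

open Matrix

variable {m n : ℕ}

theorem transpose_mul_self_apply_nonneg {a b : ℕ} (M : Matrix (Fin a) (Fin b) ℝ) (i : Fin b) :
    0 ≤ (Mᵀ * M) i i := by
  simp only [mul_apply, transpose_apply]
  exact Finset.sum_nonneg fun j _ => mul_self_nonneg _

theorem transpose_mul_apply_le {a b : ℕ} (M N : Matrix (Fin a) (Fin b) ℝ) (i : Fin b) :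
    (Mᵀ * N) i i ≤ ((Mᵀ * M) i i + (Nᵀ * N) i i) / 2 := by
  have h := transpose_mul_self_apply_nonneg (M - N) i
  have h2 : (Nᵀ * M) i i = (Mᵀ * N) i i := by
    simp only [mul_apply, transpose_apply, mul_comm]
  simp only [transpose_sub, Matrix.sub_mul, Matrix.mul_sub, Matrix.sub_apply, h2] at h
  linarith

theorem transpose_mul_proj_mul_apply_mem {a b : ℕ} {E : Matrix (Fin a) (Fin a) ℝ} (hE : Eᵀ = E)
    (hEE : E * E = E) {V : Matrix (Fin a) (Fin b) ℝ} (hV : Vᵀ * V = 1) (i : Fin b) :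
    0 ≤ (Vᵀ * E * V) i i ∧ (Vᵀ * E * V) i i ≤ 1 := by
  constructor
  · have h : Vᵀ * E * V = (E * V)ᵀ * (E * V) := by
      rw [transpose_mul, hE, Matrix.mul_assoc, Matrix.mul_assoc, ← Matrix.mul_assoc E, hEE]
    rw [h]
    exact transpose_mul_self_apply_nonneg _ _
  · have h : 1 - Vᵀ * E * V = ((1 - E) * V)ᵀ * ((1 - E) * V) := by
      have h1 : (1 - E) * (1 - E) = 1 - E := IsIdempotentElem.one_sub hEE
      rw [transpose_mul, transpose_sub, transpose_one, hE, Matrix.mul_assoc Vᵀ (1 - E),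
        ← Matrix.mul_assoc (1 - E), h1, Matrix.sub_mul, Matrix.mul_sub, Matrix.one_mul, hV, ← Matrix.mul_assoc]
    have h2 := transpose_mul_self_apply_nonneg ((1 - E) * V) i
    rw [← h, Matrix.sub_apply, one_apply_eq] at h2
    linarith

/-- The difference of the two sides is `‖E(1 - VVᵀ)‖²`. -/
theorem trace_transpose_mul_proj_mul_le {a b : ℕ} {E : Matrix (Fin a) (Fin a) ℝ} (hE : Eᵀ = E)
    (hEE : E * E = E) {V : Matrix (Fin a) (Fin b) ℝ} (hV : Vᵀ * V = 1) :
    (Vᵀ * E * V).trace ≤ E.trace := by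
  have h := trace_transpose_mul_self_nonneg (E * (1 - V * Vᵀ))
  have hVV : V * Vᵀ * (V * Vᵀ) = V * Vᵀ := by
    rw [Matrix.mul_assoc, ← Matrix.mul_assoc Vᵀ, hV, Matrix.one_mul]
  have h1 : (1 - V * Vᵀ) * (1 - V * Vᵀ)ᵀ = 1 - V * Vᵀ := by
    rw [transpose_sub, transpose_one, transpose_mul, transpose_transpose]
    exact IsIdempotentElem.one_sub hVV
  have h2 : ((E * (1 - V * Vᵀ))ᵀ * (E * (1 - V * Vᵀ))).trace = E.trace - (Vᵀ * E * V).trace := by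
    rw [trace_mul_comm, transpose_mul, hE, Matrix.mul_assoc, ← Matrix.mul_assoc (1 - V * Vᵀ), h1,
      ← Matrix.mul_assoc, trace_mul_comm, ← Matrix.mul_assoc, hEE, Matrix.mul_sub, Matrix.mul_one,
      trace_sub, ← Matrix.mul_assoc, trace_mul_comm (E * V), Matrix.mul_assoc]
  linarith

/-- A form of Ky Fan's inequality for partial isometries. -/
theorem exists_weights_of_partialIsometry (hmn : m ≤ n) {W : Matrix (Fin m) (Fin n) ℝ}
    (hW : W * Wᵀ * W = W) (Y : Matrix (Fin m) (Fin n) ℝ) :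
    ∃ b : Fin m → ℝ, (∀ i, 0 ≤ b i) ∧ (∀ i, b i ≤ 1) ∧ ∑ i, b i ≤ (Wᵀ * W).trace ∧
      inner ℝ W Y ≤ ∑ i, b i * sigma Y i := by
  obtain ⟨U, V, hU, hV, hY⟩ := exists_svd hmn Y
  have hE : (Wᵀ * W)ᵀ = Wᵀ * W := by rw [transpose_mul, transpose_transpose]
  have hEE : Wᵀ * W * (Wᵀ * W) = Wᵀ * W := by
    rw [Matrix.mul_assoc, ← Matrix.mul_assoc W, hW]
  have hF : (W * Wᵀ)ᵀ = W * Wᵀ := by rw [transpose_mul, transpose_transpose]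
  have hFF : W * Wᵀ * (W * Wᵀ) = W * Wᵀ := by rw [← Matrix.mul_assoc, hW]
  have hα := transpose_mul_proj_mul_apply_mem hF hFF hU
  have hβ := transpose_mul_proj_mul_apply_mem hE hEE hV
  have hα' := trace_transpose_mul_proj_mul_le hF hFF hU
  have hβ' := trace_transpose_mul_proj_mul_le hE hEE hV
  -- These weights are `(‖Wᵀuᵢ‖² + ‖Wvᵢ‖²)/2`. Writing `W = W Wᵀ W`, they dominate `⟨uᵢ, W vᵢ⟩` by
  -- the arithmetic-geometric mean inequality.
  refine ⟨fun i => ((Uᵀ * (W * Wᵀ) * U) i i + (Vᵀ * (Wᵀ * W) * V) i i) / 2, fun i => ?_,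
    fun i => ?_, ?_, ?_⟩
  · linarith [hα i, hβ i]
  · linarith [hα i, hβ i]
  · rw [← Finset.sum_div, Finset.sum_add_distrib]
    rw [trace_mul_comm W] at hα'
    simp only [trace, diag_apply] at hα' hβ' ⊢
    linarith
  · have h1 : inner ℝ W Y = ∑ i, (Uᵀ * W * V) i i * sigma Y i := by
      conv_lhs => rw [hY]
      rw [← real_inner_comm, inner_eq_trace, transpose_mul, transpose_mul, transpose_transpose,
        diagonal_transpose, trace_mul_comm, ← Matrix.mul_assoc, ← Matrix.mul_assoc,
        trace_mul_comm, ← Matrix.mul_assoc, ← Matrix.mul_assoc]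
      simp only [trace, diag_apply, mul_diagonal]
    rw [h1]
    refine Finset.sum_le_sum fun i _ => mul_le_mul_of_nonneg_right ?_ (sigma_nonneg Y i)
    have h2 : Uᵀ * W * V = (Wᵀ * U)ᵀ * (Wᵀ * W * V) := by
      rw [transpose_mul, transpose_transpose]
      conv_lhs => rw [← hW]
      simp only [Matrix.mul_assoc]
    have h3 := transpose_mul_apply_le (Wᵀ * U) (Wᵀ * W * V) i
    have h4 : (Wᵀ * U)ᵀ * (Wᵀ * U) = Uᵀ * (W * Wᵀ) * U := by
      rw [transpose_mul, transpose_transpose]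
      simp only [Matrix.mul_assoc]
    have h5 : (Wᵀ * W * V)ᵀ * (Wᵀ * W * V) = Vᵀ * (Wᵀ * W) * V := by
      rw [transpose_mul, hE, Matrix.mul_assoc, ← Matrix.mul_assoc (Wᵀ * W), hEE,
        ← Matrix.mul_assoc]
    rwa [h4, h5, ← h2] at h3

theorem sigma_sq_of_partialIsometry (hmn : m ≤ n) {W : Matrix (Fin m) (Fin n) ℝ}
    (hW : W * Wᵀ * W = W) : (∀ i, sigma W i = 0 ∨ sigma W i = 1) ∧
      ∑ i, sigma W i = (Wᵀ * W).trace := by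
  obtain ⟨U, V, hU, hV, hY⟩ := exists_svd hmn W
  have hWt : Wᵀ = V * diagonal (sigma W) * Uᵀ := by
    conv_lhs => rw [hY]
    simp only [transpose_mul, transpose_transpose, diagonal_transpose, Matrix.mul_assoc]
  have hinj : ∀ x y : Fin m → ℝ, U * diagonal x * Vᵀ = U * diagonal y * Vᵀ → x = y := by
    intro x y h
    have h2 := congrArg (fun M => Uᵀ * M * V) h
    simp only [Matrix.mul_assoc, hV, Matrix.mul_one] at h2
    rw [← Matrix.mul_assoc, ← Matrix.mul_assoc, hU, Matrix.one_mul, Matrix.one_mul] at h2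
    exact diagonal_injective h2
  have hcube : ∀ i, sigma W i * sigma W i * sigma W i = sigma W i := by
    have h : W * Wᵀ * W = U * diagonal (fun i => sigma W i * sigma W i * sigma W i) * Vᵀ := by
      conv_lhs => rw [hWt]
      conv_lhs => enter [1, 1]; rw [hY]
      conv_lhs => enter [2]; rw [hY]
      rw [mul_diagonal_mul_diagonal_mul hV, mul_diagonal_mul_diagonal_mul hU]
    rw [hW] at h
    intro i
    conv_lhs at h => rw [hY]
    exact (congrFun (hinj _ _ h) i).symm
  have h01 : ∀ i, sigma W i = 0 ∨ sigma W i = 1 := by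
    intro i
    have h1 := hcube i
    have h2 := sigma_nonneg W i
    have h3 : sigma W i * ((sigma W i - 1) * (sigma W i + 1)) = 0 := by linarith
    rcases mul_eq_zero.1 h3 with h | h
    · exact Or.inl h
    · rcases mul_eq_zero.1 h with h | h
      · exact Or.inr (by linarith)
      · linarith
  refine ⟨h01, ?_⟩
  have h : Wᵀ * W = V * diagonal (fun i => sigma W i * sigma W i) * Vᵀ := by
    conv_lhs => rw [hWt]
    conv_lhs => enter [2]; rw [hY]
    rw [mul_diagonal_mul_diagonal_mul hU]
  rw [h, trace_mul_cycle, hV, Matrix.one_mul, trace_diagonal]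
  refine Finset.sum_congr rfl fun i _ => ?_
  rcases h01 i with h | h <;> simp [h]

/-- With weights `b` in `[0, 1]`, `Φ̂(σ(Y)) ≥ ∑ bᵢ (1 + c(σᵢ - 1)) = (1 - c) ∑ bᵢ + c ∑ bᵢ σᵢ`.
Since `c ≥ 1` and `∑ bᵢ ≤ ‖W‖²`, this is at least `‖W‖² + ⟨cW, Y - W⟩`, and `Φ̂(σ(W)) = ‖W‖²`. -/
theorem smul_mem_limSubdiff_PhiHat (hmn : m ≤ n) {φ : ℝ → EReal} {c : ℝ} (hc : 1 ≤ c)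
    (h0 : φ 0 = 0) (h1 : φ 1 = 1) (hpos : ∀ s, 0 ≤ s → 0 ≤ φ s)
    (hsub : ∀ s, 0 ≤ s → ((1 + c * (s - 1) : ℝ) : EReal) ≤ φ s)
    {W : Matrix (Fin m) (Fin n) ℝ} (hW : W * Wᵀ * W = W) :
    c • W ∈ limSubdiff (fun Y => PhiHat φ (sigma Y)) W := by
  obtain ⟨h01, htr⟩ := sigma_sq_of_partialIsometry hmn hW
  have hval : PhiHat φ (sigma W) = (((Wᵀ * W).trace : ℝ) : EReal) := by
    rw [← htr, ereal_coe_sum]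
    refine Finset.sum_congr rfl fun i _ => ?_
    rcases h01 i with h | h <;> simp [hat, h, h0, h1]
  refine regSubdiff_subset_limSubdiff _ _ ⟨?_, ?_, fun ε hε => Eventually.of_forall fun Y => ?_⟩
  · simp only [hval]
    exact EReal.coe_ne_top _
  · simp only [hval]
    exact EReal.coe_ne_bot _
  simp only [hval]
  obtain ⟨b, hb0, hb1, hbr, hbW⟩ := exists_weights_of_partialIsometry hmn hW Y
  have hlow : ((∑ i, b i * (1 + c * (sigma Y i - 1)) : ℝ) : EReal) ≤ PhiHat φ (sigma Y) := by
    rw [ereal_coe_sum]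
    refine Finset.sum_le_sum fun i _ => ?_
    have hs := sigma_nonneg Y i
    unfold hat
    rw [abs_of_nonneg hs]
    rcases le_total 0 (1 + c * (sigma Y i - 1)) with h | h
    · exact (EReal.coe_le_coe_iff.2 (mul_le_of_le_one_left h (hb1 i))).trans (hsub _ hs)
    · refine le_trans ?_ (hpos _ hs)
      rw [← EReal.coe_zero, EReal.coe_le_coe_iff]
      exact mul_nonpos_of_nonneg_of_nonpos (hb0 i) h
  refine le_trans ?_ hlow
  rw [← EReal.coe_add, EReal.coe_le_coe_iff]
  have hsum : ∑ i, b i * (1 + c * (sigma Y i - 1))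
      = (1 - c) * ∑ i, b i + c * ∑ i, b i * sigma Y i := by
    rw [Finset.mul_sum, Finset.mul_sum, ← Finset.sum_add_distrib]
    exact Finset.sum_congr rfl fun i _ => by ring
  rw [hsum, inner_smul_left, inner_sub_right, inner_eq_trace W W]
  have hn : 0 ≤ ε * ‖Y - W‖ := by positivity
  have h2 := mul_le_mul_of_nonneg_left hbW (by linarith : 0 ≤ c)
  have h3 := mul_le_mul_of_nonneg_left hbr (by linarith : 0 ≤ c - 1)
  simp only [conj_trivial]
  linarith

/-- Let `E` be the orthogonal projection onto the row space of `X`. `WᵀW` fixes its range, so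
`tr(WᵀW) - tr E = ‖W(1 - E)‖²`. -/
theorem rank_le_trace_of_isPolarPair (hmn : m ≤ n) {X W : Matrix (Fin m) (Fin n) ℝ}
    (h : IsPolarPair X W) : (X.rank : ℝ) ≤ (Wᵀ * W).trace := by
  obtain ⟨Z, A, h1, h2, h3, -, -⟩ := exists_partialIsometry hmn X
  rw [← trace_transpose_mul_self_eq_rank h1 h2 h3]
  set E := Zᵀ * Z with hE
  have hEt : Eᵀ = E := by rw [hE, transpose_mul, transpose_transpose]
  have hEE : E * E = E := by rw [h3, ← Matrix.mul_assoc, h2]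
  have hPt := transpose_eq_of_posSemidef h.2.1
  have hWE : Wᵀ * W * E = E := by
    have hX : Xᵀ = Wᵀ * X * Wᵀ := by
      conv_lhs => rw [← h.2.2]
      rw [transpose_mul, transpose_mul, transpose_transpose, ← Matrix.mul_assoc,
        ← transpose_transpose W, ← transpose_mul, transpose_transpose, hPt]
    have hE' : E = Wᵀ * X * (Wᵀ * Aᵀ) := by
      rw [← hEt, h3, transpose_mul, hX]
      simp only [Matrix.mul_assoc]
    rw [hE', ← Matrix.mul_assoc, h.transpose_mul_mul]
  have hnn := trace_transpose_mul_self_nonneg (W * (1 - E))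
  have hexp : ((W * (1 - E))ᵀ * (W * (1 - E))).trace = (Wᵀ * W).trace - E.trace := by
    have h4 : (1 - E) * (1 - E) = 1 - E := IsIdempotentElem.one_sub hEE
    rw [transpose_mul, transpose_sub, transpose_one, hEt, ← Matrix.mul_assoc, trace_mul_cycle,
      ← Matrix.mul_assoc, h4, Matrix.mul_assoc, trace_mul_comm, Matrix.mul_sub, hWE,
      Matrix.mul_one, trace_sub]
  linarith

/-- Every such `X'` is killed by `1 - W'W'ᵀ`, whose rank near `W` is at least that of `1 - WWᵀ`,
namely `m - rank X`. -/
theorem eventually_rank_le_of_isPolarPair {X W : Matrix (Fin m) (Fin n) ℝ}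
    (hW : W * Wᵀ * W = W) (htr : (Wᵀ * W).trace = X.rank) :
    ∀ᶠ W' in 𝓝 W, ∀ X', IsPolarPair X' W' → X'.rank ≤ X.rank := by
  have hc : Continuous fun W : Matrix (Fin m) (Fin n) ℝ => 1 - W * Wᵀ := by fun_prop
  have hFF : W * Wᵀ * (W * Wᵀ) = W * Wᵀ := by rw [← Matrix.mul_assoc, hW]
  have hrk : ((1 - W * Wᵀ).rank : ℝ) = m - X.rank := by
    rw [← trace_eq_rank_of_mul_self, trace_sub, trace_one, trace_mul_comm, htr, Fintype.card_fin]
    exact IsIdempotentElem.one_sub hFF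
  filter_upwards [hc.continuousAt.eventually (eventually_rank_le (1 - W * Wᵀ))] with W' hW' X' h
  have h1 : (1 - W' * W'ᵀ) * X' = 0 := by rw [Matrix.sub_mul, Matrix.one_mul, h.2.2, sub_self]
  have h2 := rank_add_rank_le_card_of_mul_eq_zero h1
  rw [Fintype.card_fin] at h2
  have h3 : ((1 - W' * W'ᵀ).rank : ℝ) + X'.rank ≤ m := by exact_mod_cast h2
  have h4 : ((1 - W * Wᵀ).rank : ℝ) ≤ (1 - W' * W'ᵀ).rank := by exact_mod_cast hW'
  have : (X'.rank : ℝ) ≤ X.rank := by linarith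
  exact_mod_cast this

/-- Near `(X, W)` on the graph, `X'` has rank at most `rank X`, so `H` contributes `o(‖X' - X‖)`.
Moreover `‖W'‖² ≥ rank X' ≥ rank X = ‖W‖²`, so `-c⟨W, W' - W⟩ ≤ (c/2)‖W' - W‖²`, which is of second
order. -/
theorem mem_coderivative_of_mul_transpose_eq_zero (hmn : m ≤ n)
    {X W H : Matrix (Fin m) (Fin n) ℝ} (hXW : IsPolarPair X W) (hW : W * Wᵀ * W = W)
    (htr : (Wᵀ * W).trace = X.rank) (h1 : H * Xᵀ = 0) (h2 : Xᵀ * H = 0) {c : ℝ} (hc : 0 ≤ c) :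
    H ∈ coderivative subdiffNuclear X W (c • W) := by
  set z : WithLp 2 (Matrix (Fin m) (Fin n) ℝ × Matrix (Fin m) (Fin n) ℝ) :=
    WithLp.toLp 2 (X, W) with hz
  have hzmem : z ∈ graph subdiffNuclear := (mem_subdiffNuclear_iff hmn).2 hXW
  suffices hreg : WithLp.toLp 2 (H, -(c • W)) ∈ regNormalCone (graph subdiffNuclear) z from
    ⟨hzmem, fun _ => z, fun _ => _, fun _ => hzmem, tendsto_const_nhds, tendsto_const_nhds,
      fun _ => hreg⟩
  refine ⟨hzmem, fun ε hε => ?_⟩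
  have hfst : Tendsto (fun p : WithLp 2 (Matrix (Fin m) (Fin n) ℝ × Matrix (Fin m) (Fin n) ℝ) =>
      p.fst) (𝓝[graph subdiffNuclear] z) (𝓝 X) :=
    ((WithLp.prod_continuous_ofLp 2 _ _).fst.tendsto z).mono_left nhdsWithin_le_nhds
  have hsnd : Tendsto (fun p : WithLp 2 (Matrix (Fin m) (Fin n) ℝ × Matrix (Fin m) (Fin n) ℝ) =>
      p.snd) (𝓝[graph subdiffNuclear] z) (𝓝 W) :=
    ((WithLp.prod_continuous_ofLp 2 _ _).snd.tendsto z).mono_left nhdsWithin_le_nhds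
  have hH := eventually_nhdsWithin_iff.1
    ((mem_regNormalCone_rank_le hmn h1 h2).2 (ε / 2) (by positivity))
  have hsmall : ∀ᶠ W' in 𝓝 W, c / 2 * ‖W' - W‖ < ε / 2 := by
    have hcont : Continuous fun W' : Matrix (Fin m) (Fin n) ℝ => c / 2 * ‖W' - W‖ := by fun_prop
    have h := hcont.tendsto W
    rw [sub_self, norm_zero, mul_zero] at h
    exact h.eventually (gt_mem_nhds (by positivity))
  filter_upwards [hfst.eventually hH, hfst.eventually (eventually_rank_le X),
    hsnd.eventually (eventually_rank_le_of_isPolarPair hW htr), hsnd.eventually hsmall,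
    self_mem_nhdsWithin] with p hp1 hp2 hp3 hp4 hp5
  have hp : IsPolarPair p.fst p.snd := (mem_subdiffNuclear_iff hmn).1 hp5
  have hA := hp1 (hp3 _ hp)
  have hnorm : ‖W‖ ^ 2 ≤ ‖p.snd‖ ^ 2 := by
    rw [← real_inner_self_eq_norm_sq, ← real_inner_self_eq_norm_sq, inner_eq_trace,
      inner_eq_trace, htr]
    exact le_trans (by exact_mod_cast hp2) (rank_le_trace_of_isPolarPair hmn hp)
  have hB : -inner ℝ W (p.snd - W) ≤ ‖p.snd - W‖ ^ 2 / 2 := by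
    have h := norm_sub_sq_real p.snd W
    rw [inner_sub_right, real_inner_self_eq_norm_sq]
    rw [real_inner_comm] at h
    linarith
  have hin : inner ℝ (WithLp.toLp 2 (H, -(c • W))) (p - z)
      = inner ℝ H (p.fst - X) + c * -inner ℝ W (p.snd - W) := by
    rw [WithLp.prod_inner_apply]
    simp only [hz, WithLp.ofLp_sub, Prod.fst_sub, Prod.snd_sub, inner_neg_left, inner_smul_left,
      conj_trivial, mul_neg]
    rfl
  have hn1 : ‖p.fst - X‖ ≤ ‖p - z‖ := WithLp.norm_fst_le _ (p - z)
  have hn2 : ‖p.snd - W‖ ≤ ‖p - z‖ := WithLp.norm_snd_le _ (p - z)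
  rw [hin]
  have hC := mul_le_mul_of_nonneg_left hB hc
  have hD : c * (‖p.snd - W‖ ^ 2 / 2) ≤ ε / 2 * ‖p.snd - W‖ := by
    calc c * (‖p.snd - W‖ ^ 2 / 2) = c / 2 * ‖p.snd - W‖ * ‖p.snd - W‖ := by ring
      _ ≤ ε / 2 * ‖p.snd - W‖ := by gcongr
  nlinarith

end PartialIsometry

end RankReg

theorem mainTheorem1 (m n : ℕ) (hmn : m ≤ n)
    (f : Matrix (Fin m) (Fin n) ℝ → ℝ) (hf : LocallyLipschitz f)
    (Ω : Set (Matrix (Fin m) (Fin n) ℝ)) (hΩclosed : IsClosed Ω) (hΩconvex : Convex ℝ Ω)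
    (hreg : ∀ X ∈ Ω, RankReg.regSubdiff (fun Y => (f Y : EReal)) X
      = RankReg.limSubdiff (fun Y => (f Y : EReal)) X)
    (ν : ℝ) (hν : 0 < ν) (X : Matrix (Fin m) (Fin n) ℝ) :
    (∀ φ : ℝ → EReal, RankReg.IsClassL1 φ →
      RankReg.IsMStationary ν f Ω φ X → RankReg.IsRStationary ν f Ω X) ∧
    (RankReg.IsRStationary ν f Ω X →
      ∀ φ : ℝ → EReal, RankReg.IsClassL φ →
        (0 : ℝ) ∈ RankReg.limSubdiff (RankReg.hat φ) 0 →
        RankReg.IsMStationary ν f Ω φ X) := by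
  constructor
  · rintro φ - ⟨W, -, D, hD, h⟩
    rw [add_right_comm] at h
    exact Set.add_subset_add
      (Set.add_subset_add subset_rfl (RankReg.coderivative_subset_limSubdiff_rankFun hmn hD))
      subset_rfl h
  · intro h φ hφ h0
    -- This `W` has the least norm among subgradients at `X`, with `‖W‖² = rank X`.
    obtain ⟨W, A, hA1, hA2, hWA, hW, hXW⟩ := RankReg.exists_partialIsometry hmn X
    have htr := RankReg.trace_transpose_mul_self_eq_rank hA1 hA2 hWA
    have hφ0 := hφ.map_zero h0
    obtain ⟨c, hc, hsub⟩ := hφ.exists_subgradient_one hφ0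
    refine ⟨W, (RankReg.mem_subdiffNuclear_iff hmn).2 hXW, c • W,
      RankReg.smul_mem_limSubdiff_PhiHat hmn hc hφ0 hφ.map_one
        (fun s hs => hφ0 ▸ hφ.map_zero_le h0 hs) hsub hW, ?_⟩
    rw [add_right_comm]
    refine Set.add_subset_add (Set.add_subset_add subset_rfl fun H hH => ?_) subset_rfl h
    obtain ⟨h1, h2⟩ := RankReg.mul_transpose_eq_zero_of_mem_limSubdiff_rankFun hH
    exact RankReg.mem_coderivative_of_mul_transpose_eq_zero hmn hXW hW htr h1 h2 (by linarith)
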